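/- Let $D\subseteq\mathbb R^n$ be open and convex, let $X\subseteq D$ be nonempty, closed and convex, let $\epsilon>0$, put $X_\epsilon=\{x+z: x\in X,\ \|z\|\le\epsilon\}$ (Euclidean norm), and assume $X_\epsilon\subseteq D$. Let $\xi$ be a random vector whose distribution is carried by a set $\Omega\subseteq\mathbb R^d$, and let $F:D\times\Omega\to\mathbb R$ be such that $F(\cdot,\xi)$ is convex on $D$ for every $\xi\in\Omega$, and $f(x)=\mathbb E[F(x,\xi)]$ is finite for every $x\in D$. Write $\partial_xF(x,\xi)$ for the set of $s\in\mathbb R^n$ with $F(x,\xi)+s^T(y-x)\le F(y,\xi)$ for all $y\in D$, and assume that there is a constant $C$ with $\|s\|\le C$ for all $s\in\partial_xF(x,\xi)$, $x\in X_\epsilon$, $\xi\in\Omega$. Let $z$ be uniformly distributed on the ball $\{z\in\mathbb R^n:\|z\|\le\epsilon\}$ and independent of $\xi$, and let $\hat f(x)=\mathbb E[F(x+z,\xi)]$. Let the deterministic stepsizes $\gamma_k>0$ satisfy $\sum_{k\ge0}\gamma_k=\infty$ and $\sum_{k\ge0}\gamma_k^2<\infty$. Then: (i) $\hat f(x)$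 is well defined and finite for every $x\in X$, and the optimal values $f^*=\inf_{x\in X}f(x)$ and $\hat f^*=\inf_{x\in X}\hat f(x)$ (in $[-\infty,\infty)$) satisfy $f^*\le\hat f^*\le f^*+\epsilon C$. (ii) Assume in addition that the problem $\min_{x\in X}\hat f(x)$ has an optimal solution. Let $x_0\in X$ be a random initial point with $\mathbb E\|x_0\|^2<\infty$, let $(z_k,\xi_k)$, $k\ge0$, be independent copies of $(z,\xi)$ that are jointly independent of $x_0$, and let $$x_{k+1}=\Pi_X\left[x_k-\gamma_k s_k\right],\qquad s_k\in\partial_xF(x_k+z_k,\xi_k),\qquad k\ge0,$$ where $\Pi_X$ is the Euclidean projection on $X$ and the $s_k$ are random vectors that are otherwise arbitrary. Then $(x_k)$ converges almost surely to some (random) optimal solution of $\min_{x\in X}\hat f(x)$. -/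

import Mathlib

open MeasureTheory ProbabilityTheory Filter Topology

namespace LocalSmoothing

/-- `ℝⁿ` with the Euclidean norm. -/
abbrev Vec (n : ℕ) : Type := EuclideanSpace ℝ (Fin n)

/-- `X_ε = { x + z : x ∈ X, ‖z‖ ≤ ε }`. -/
def enlarge {n : ℕ} (X : Set (Vec n)) (ε : ℝ) : Set (Vec n) :=
  {y | ∃ x ∈ X, ∃ z : Vec n, ‖z‖ ≤ ε ∧ y = x + z}

/-- The subdifferential at `x` of a function `h` with domain `D`: all `g` with
`h x + ⟪g, y - x⟫ ≤ h y` for every `y ∈ D`. -/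
def subdiff {n : ℕ} (D : Set (Vec n)) (h : Vec n → ℝ) (x : Vec n) : Set (Vec n) :=
  {g | ∀ y ∈ D, h x + inner ℝ g (y - x) ≤ h y}

/-- `p` is the Euclidean projection of `v` on `X`
(for a nonempty closed convex `X` there is exactly one such `p`). -/
def IsProj {n : ℕ} (X : Set (Vec n)) (v p : Vec n) : Prop :=
  p ∈ X ∧ ∀ y ∈ X, ‖v - p‖ ≤ ‖v - y‖

/-- The uniform distribution on the closed ball of radius `ε` centred at the origin of `ℝⁿ`. -/
noncomputable def unifBall (n : ℕ) (ε : ℝ) : Measure (Vec n) :=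
  ProbabilityTheory.cond volume (Metric.closedBall (0 : Vec n) ε)

/-- The original objective `f(x) = E[F(x, ξ)]`, where `ξ` has law `ν`. -/
noncomputable def objective {n d : ℕ} (F : Vec n → Vec d → ℝ) (ν : Measure (Vec d))
    (x : Vec n) : ℝ :=
  ∫ ξ, F x ξ ∂ν

/-- The smoothed integrand `F̂(x, ξ) = E[F(x + z, ξ)]`, where `z` is uniform on the `ε`-ball. -/
noncomputable def smoothF {n d : ℕ} (F : Vec n → Vec d → ℝ) (ε : ℝ)
    (x : Vec n) (ξ : Vec d) : ℝ :=
  ∫ z, F (x + z) ξ ∂(unifBall n ε)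

/-- The smoothed objective `f̂(x) = E[F̂(x, ξ)]`. -/
noncomputable def smoothObjective {n d : ℕ} (F : Vec n → Vec d → ℝ) (ν : Measure (Vec d))
    (ε : ℝ) (x : Vec n) : ℝ :=
  ∫ ξ, smoothF F ε x ξ ∂ν

/-- The optimal value `inf_{x ∈ X} h(x)`, as an extended real number. -/
noncomputable def optValue {n : ℕ} (X : Set (Vec n)) (h : Vec n → ℝ) : EReal :=
  ⨅ x ∈ X, (h x : EReal)

/-- The set of optimal solutions of `min_{x ∈ X} h(x)`. -/
def optSet {n : ℕ} (X : Set (Vec n)) (h : Vec n → ℝ) : Set (Vec n) :=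
  {x | x ∈ X ∧ ∀ y ∈ X, h x ≤ h y}

/-- The processes `x, z, s` (in `ℝⁿ`) and `ξ` (in `ℝᵈ`) on the probability space `(W, P)` form a
run of the stochastic subgradient method with stepsizes `γ`:
`x_{k+1} = Π_X[x_k - γ_k s_k]` with `s_k ∈ ∂_x F(x_k + z_k, ξ_k)`. -/
structure IsRun {n d : ℕ} (D X : Set (Vec n)) (F : Vec n → Vec d → ℝ) (ν : Measure (Vec d))
    (ε : ℝ) (γ : ℕ → ℝ) {W : Type*} [MeasurableSpace W] (P : Measure W)
    (x z s : ℕ → W → Vec n) (ξ : ℕ → W → Vec d) : Prop where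
  measurable_z : ∀ k, Measurable (z k)
  measurable_xi : ∀ k, Measurable (ξ k)
  /-- The subgradients are random vectors; how they are selected is left free. -/
  aemeasurable_s : ∀ k, AEMeasurable (s k) P
  measurable_init : Measurable (x 0)
  init_mem : ∀ᵐ ω ∂P, x 0 ω ∈ X
  /-- `E‖x₀‖² < ∞`. -/
  init_memLp : MemLp (x 0) 2 P
  /-- `z_k` is uniform on the ball, `ξ_k` has law `ν`, and the two are independent. -/
  law_sample : ∀ k, P.map (fun ω => (z k ω, ξ k ω)) = (unifBall n ε).prod ν
  /-- The samples of different iterations are mutually independent. -/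
  indep_sample : iIndepFun (fun k ω => (z k ω, ξ k ω)) P
  /-- The initial point is independent of all the samples. -/
  indep_init : IndepFun (x 0) (fun ω k => (z k ω, ξ k ω)) P
  subgradient : ∀ k, ∀ᵐ ω ∂P, s k ω ∈ subdiff D (fun y => F y (ξ k ω)) (x k ω + z k ω)
  step : ∀ k, ∀ᵐ ω ∂P, IsProj X (x k ω - γ k • s k ω) (x (k + 1) ω)

end LocalSmoothing

/-! The bound on subgradients makes `F (·, ξ)` `C`-Lipschitz on `enlarge X ε`. Moving the argument
by at most `ε` therefore raises the value by at most `ε * C`, while averaging over the symmetric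
ball cannot lower a convex function. This gives part (i).

For part (ii), each `s k` is chosen arbitrarily, perhaps with knowledge of other samples. But `z k`
has a density and is independent of the past, so by Rademacher's theorem `F (·, ξ k)` is almost
surely differentiable at `x k + z k` and has only one subgradient there. The run thus agrees almost
surely with an adapted process (`IsRun.ae_eq_adaptedRun`). Since `F` is not assumed jointly
measurable, that process is built from a jointly measurable surrogate `G`, a McShane extension over
a countable dense set.

Expanding the squared distance to a minimizer `y` and integrating out the fresh sample yields an
almost-supermartingale inequality with drift `2 γ_k (f̂(x_k) - f̂(y))` and error `C² γ_k²`.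
Robbins–Siegmund gives convergence of the distance to `y` and summability of the weighted gaps,
simultaneously for a countable dense set of minimizers. As `γ` is not summable, a subsequence of
gaps vanishes; a cluster point of it is a minimizer, and convergence of the distances forces the
whole sequence to it. -/

namespace LocalSmoothing

/-! ### Subgradients of convex functions and joint measurability -/

variable {n d : ℕ}

/-- A convex function on an open set has a subgradient at each point of the set. -/
theorem subdiff_nonempty {D : Set (Vec n)} (hD : IsOpen D) {h : Vec n → ℝ}
    (hconv : ConvexOn ℝ D h) {x : Vec n} (hx : x ∈ D) : (subdiff D h x).Nonempty := by
  have hcont : ContinuousOn h D := hconv.continuousOn hD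
  have hopen : IsOpen {p : Vec n × ℝ | p.1 ∈ D ∧ h p.1 < p.2} := by
    rw [isOpen_iff_mem_nhds]
    rintro ⟨y, t⟩ ⟨hy, ht⟩
    have h1 : ContinuousAt (fun p : Vec n × ℝ => h p.1) (y, t) :=
      ContinuousAt.comp (x := (y, t)) (hcont.continuousAt (hD.mem_nhds hy)) continuousAt_fst
    have h2 : ∀ᶠ p : Vec n × ℝ in 𝓝 (y, t), h p.1 < p.2 := h1.eventually_lt continuousAt_snd ht
    have h3 : ∀ᶠ p : Vec n × ℝ in 𝓝 (y, t), p.1 ∈ D :=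
      continuousAt_fst.eventually (hD.mem_nhds hy)
    exact h3.and h2
  -- Separate the open strict epigraph from `(x, h x)`. The vertical component `c` of the functional
  -- is negative, so dividing by `-c` turns its horizontal part into a slope.
  obtain ⟨f, hf⟩ := geometric_hahn_banach_open_point (x := (x, h x))
    hconv.convex_strict_epigraph hopen (fun hmem => lt_irrefl _ hmem.2)
  have hsplit : ∀ y t, f (y, t) = f (y, 0) + t * f (0, 1) := by
    intro y t
    have : ((y, t) : Vec n × ℝ) = (y, 0) + t • ((0 : Vec n), (1 : ℝ)) := by simp
    rw [this, map_add, map_smul, smul_eq_mul]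
  set c := f (0, 1) with hc
  have hcneg : c < 0 := by
    have := hf (x, h x + 1) ⟨hx, by simp⟩
    rw [hsplit, hsplit x (h x)] at this
    linarith
  let φ : Vec n →L[ℝ] ℝ := f.comp (ContinuousLinearMap.inl ℝ (Vec n) ℝ)
  refine ⟨(InnerProductSpace.toDual ℝ (Vec n)).symm ((-c)⁻¹ • φ), fun y hy => ?_⟩
  rw [InnerProductSpace.toDual_symm_apply]
  have hle : φ y + h y * c ≤ φ x + h x * c := by
    -- The graph itself lies outside the strict epigraph, so it is approached from above; the height
    -- `δ / (-c)` costs exactly `δ`.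
    refine le_of_forall_pos_le_add fun δ hδ => ?_
    have := hf (y, h y + δ / (-c)) ⟨hy, by have := div_pos hδ (neg_pos.2 hcneg); simp; linarith⟩
    rw [hsplit, hsplit x (h x)] at this
    have hc0 : c ≠ 0 := hcneg.ne
    have h3 : δ / (-c) * c = -δ := by field_simp
    have h4 : φ y = f (y, 0) := rfl
    have h5 : φ x = f (x, 0) := rfl
    rw [h4, h5]
    linarith
  have h6 : ((-c)⁻¹ • φ) (y - x) = (-c)⁻¹ * (φ y - φ x) := by simp
  rw [h6]
  have h7 : (-c)⁻¹ * (φ y - φ x) ≤ (-c)⁻¹ * ((-c) * (h y - h x)) :=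
    mul_le_mul_of_nonneg_left (by linarith) (inv_nonneg.2 (by linarith))
  rw [inv_mul_cancel_left₀ (by linarith)] at h7
  linarith

/-- A uniform bound on the subgradients at the points of `E` gives a one-sided Lipschitz bound. -/
theorem sub_le_of_subdiff_bound {D E : Set (Vec n)} (hD : IsOpen D) (hED : E ⊆ D)
    {h : Vec n → ℝ} (hconv : ConvexOn ℝ D h) {C : ℝ}
    (hC : ∀ x ∈ E, ∀ s ∈ subdiff D h x, ‖s‖ ≤ C) {x y : Vec n} (hx : x ∈ E) (hy : y ∈ D) :
    h x - h y ≤ C * ‖x - y‖ := by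
  obtain ⟨s, hs⟩ := subdiff_nonempty hD hconv (hED hx)
  have h1 := hs y hy
  have h2 : -(inner ℝ s (y - x)) ≤ ‖s‖ * ‖x - y‖ := by
    rw [← inner_neg_right, neg_sub]
    exact real_inner_le_norm _ _
  have h3 : ‖s‖ * ‖x - y‖ ≤ C * ‖x - y‖ := mul_le_mul_of_nonneg_right (hC x hx s hs) (norm_nonneg _)
  linarith

theorem abs_sub_le_of_subdiff_bound {D E : Set (Vec n)} (hD : IsOpen D) (hED : E ⊆ D)
    {h : Vec n → ℝ} (hconv : ConvexOn ℝ D h) {C : ℝ}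
    (hC : ∀ x ∈ E, ∀ s ∈ subdiff D h x, ‖s‖ ≤ C) {x y : Vec n} (hx : x ∈ E) (hy : y ∈ E) :
    |h x - h y| ≤ C * ‖x - y‖ := by
  rw [abs_sub_le_iff]
  refine ⟨sub_le_of_subdiff_bound hD hED hconv hC hx (hED hy), ?_⟩
  rw [norm_sub_rev]
  exact sub_le_of_subdiff_bound hD hED hconv hC hy (hED hx)

/-- A family of functions that is Lipschitz on `E` in the first variable and almost everywhere
measurable in the second agrees on `E`, for almost every parameter, with a jointly measurable
function. -/
theorem exists_measurable_extension {E : Set (Vec n)} (hE : E.Nonempty)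
    {ν : Measure (Vec d)} {F : Vec n → Vec d → ℝ} {C : ℝ}
    (hmeas : ∀ x ∈ E, AEStronglyMeasurable (F x) ν)
    (hLip : ∀ᵐ ξ ∂ν, ∀ x ∈ E, ∀ y ∈ E, |F x ξ - F y ξ| ≤ C * ‖x - y‖) :
    ∃ G : Vec n × Vec d → ℝ, Measurable G ∧ ∀ᵐ ξ ∂ν, ∀ y ∈ E, G (y, ξ) = F y ξ := by
  have : Nonempty E := hE.to_subtype
  let q : ℕ → E := TopologicalSpace.denseSeq E
  have hm : ∀ i, AEStronglyMeasurable (F (q i)) ν := fun i => hmeas _ (q i).2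
  let H : ℕ → Vec d → ℝ := fun i => (hm i).mk
  have hH : ∀ i, Measurable (H i) := fun i => (hm i).stronglyMeasurable_mk.measurable
  -- McShane's formula over a countable dense set only: the infimum stays measurable, and replacing
  -- each `F (q i)` by a measurable version discards countably many null sets.
  refine ⟨fun p => ⨅ i, (H i p.2 + C * ‖p.1 - q i‖), ?_, ?_⟩
  · refine Measurable.iInf fun i => ?_
    have := hH i
    fun_prop
  · have hall : ∀ᵐ ξ ∂ν, ∀ i, F (q i) ξ = H i ξ := ae_all_iff.2 fun i => (hm i).ae_eq_mk
    filter_upwards [hLip, hall] with ξ hξ hξH y hy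
    have hlow : ∀ i, F y ξ ≤ H i ξ + C * ‖y - q i‖ := fun i => by
      have := (abs_le.1 (hξ y hy (q i) (q i).2)).2
      rw [← hξH i]; linarith
    refine le_antisymm ?_ (le_ciInf hlow)
    have hbdd : BddBelow (Set.range fun i => H i ξ + C * ‖y - q i‖) :=
      ⟨F y ξ, by rintro _ ⟨i, rfl⟩; exact hlow i⟩
    refine le_of_forall_pos_le_add fun δ hδ => ?_
    have hdense : DenseRange q := TopologicalSpace.denseRange_denseSeq E
    -- The `i`-th term exceeds `F y ξ` by at most `2 * C * ‖y - q i‖`; `|C| + 1` avoids any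
    -- assumption on the sign of `C`.
    obtain ⟨i, hi⟩ := hdense.exists_dist_lt (⟨y, hy⟩ : E)
      (show 0 < δ / (2 * (|C| + 1)) by positivity)
    refine (ciInf_le hbdd i).trans ?_
    have h1 := (abs_le.1 (hξ y hy (q i) (q i).2)).1
    rw [← hξH i]
    have h2 : ‖y - q i‖ < δ / (2 * (|C| + 1)) := by
      rw [← dist_eq_norm]; exact hi
    rw [lt_div_iff₀ (by positivity)] at h2
    nlinarith [le_abs_self C, norm_nonneg (y - (q i : Vec n)),
      mul_le_mul_of_nonneg_right (le_abs_self C) (norm_nonneg (y - (q i : Vec n)))]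

end LocalSmoothing

/-! ### Regular points, where the subgradient is unique -/

namespace LocalSmoothing

variable {n d : ℕ}

/-- The upper limit of the difference quotients of `G (·, ξ)` at `y` in the direction `v`,
where `p = (y, ξ)`. -/
noncomputable def upperDeriv (G : Vec n × Vec d → ℝ) (v : Vec n) (p : Vec n × Vec d) : EReal :=
  limsup (fun m : ℕ =>
    ((((m : ℝ) + 1) * (G (p.1 + ((m : ℝ) + 1)⁻¹ • v, p.2) - G p) : ℝ) : EReal)) atTop

/-- The set of `(y, ξ)` at which the two one-sided upper partial derivatives agree. -/
def regularSet (G : Vec n × Vec d → ℝ) : Set (Vec n × Vec d) :=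
  {p | ∀ i : Fin n, upperDeriv G (EuclideanSpace.single i 1) p =
    -upperDeriv G (-EuclideanSpace.single i 1) p}

/-- The vector of the one-sided upper partial derivatives. -/
noncomputable def upperGrad (G : Vec n × Vec d → ℝ) (p : Vec n × Vec d) : Vec n :=
  WithLp.toLp 2 fun i => (upperDeriv G (EuclideanSpace.single i 1) p).toReal

/-- Taking the steps `1 / (m + 1)` makes this a countable limsup, and values in `EReal` make it
meaningful for every `G`. -/
theorem measurable_upperDeriv {G : Vec n × Vec d → ℝ} (hG : Measurable G) (v : Vec n) :
    Measurable (upperDeriv G v) := by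
  refine Measurable.limsup fun m => ?_
  refine measurable_coe_real_ereal.comp ?_
  fun_prop

theorem measurableSet_regularSet {G : Vec n × Vec d → ℝ} (hG : Measurable G) :
    MeasurableSet (regularSet G) := by
  have : regularSet G = ⋂ i : Fin n, {p | upperDeriv G (EuclideanSpace.single i 1) p =
      -upperDeriv G (-EuclideanSpace.single i 1) p} := by
    ext p; simp [regularSet]
  rw [this]
  refine MeasurableSet.iInter fun i => measurableSet_eq_fun (measurable_upperDeriv hG _) ?_
  exact continuous_neg.measurable.comp (measurable_upperDeriv hG _)

theorem measurable_upperGrad {G : Vec n × Vec d → ℝ} (hG : Measurable G) :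
    Measurable (upperGrad G) := by
  refine (WithLp.measurable_toLp 2 (Fin n → ℝ)).comp (measurable_pi_lambda _ fun i => ?_)
  exact measurable_ereal_toReal.comp (measurable_upperDeriv hG _)

theorem eventually_add_inv_smul_mem {E : Set (Vec n)} {y : Vec n} (hE : E ∈ 𝓝 y) (v : Vec n) :
    ∀ᶠ m : ℕ in atTop, y + ((m : ℝ) + 1)⁻¹ • v ∈ E := by
  have h1 : Tendsto (fun m : ℕ => ((m : ℝ) + 1)⁻¹) atTop (𝓝 0) := by
    simpa [one_div] using tendsto_one_div_add_atTop_nhds_zero_nat (𝕜 := ℝ)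
  have h2 : Tendsto (fun m : ℕ => y + ((m : ℝ) + 1)⁻¹ • v) atTop (𝓝 (y + (0 : ℝ) • v)) :=
    tendsto_const_nhds.add (h1.smul_const v)
  rw [zero_smul, add_zero] at h2
  exact h2 hE

variable {G : Vec n × Vec d → ℝ} {D E : Set (Vec n)} {h : Vec n → ℝ} {ξ : Vec d} {y : Vec n}

/-- The subgradient inequality bounds every difference quotient from below once the displaced point
lies in `E`. -/
theorem inner_le_upperDeriv (hED : E ⊆ D) (hGh : ∀ x ∈ E, G (x, ξ) = h x) (hE : E ∈ 𝓝 y)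
    {s : Vec n} (hs : s ∈ subdiff D h y) (v : Vec n) :
    ((inner ℝ s v : ℝ) : EReal) ≤ upperDeriv G v (y, ξ) := by
  refine le_trans (le_liminf_of_le (by isBoundedDefault) ?_) liminf_le_limsup
  filter_upwards [eventually_add_inv_smul_mem hE v] with m hm
  rw [EReal.coe_le_coe_iff, hGh _ hm, hGh _ (mem_of_mem_nhds hE)]
  have h1 := hs _ (hED hm)
  rw [add_sub_cancel_left, inner_smul_right] at h1
  have hm0 : (0 : ℝ) < (m : ℝ) + 1 := by positivity
  have h2 : ((m : ℝ) + 1) * (((m : ℝ) + 1)⁻¹ * inner ℝ s v) ≤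
      ((m : ℝ) + 1) * (h (y + ((m : ℝ) + 1)⁻¹ • v) - h y) :=
    mul_le_mul_of_nonneg_left (by linarith) hm0.le
  rwa [mul_inv_cancel_left₀ hm0.ne'] at h2

/-- At a regular point there is only one subgradient, and it is the upper gradient. -/
theorem eq_upperGrad_of_mem_subdiff (hED : E ⊆ D) (hGh : ∀ x ∈ E, G (x, ξ) = h x)
    (hE : E ∈ 𝓝 y) (hreg : (y, ξ) ∈ regularSet G) {s : Vec n} (hs : s ∈ subdiff D h y) :
    s = upperGrad G (y, ξ) := by
  ext i
  -- The directions `±e_i` squeeze `s i` between two quantities that coincide at a regular point.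
  have h1 := inner_le_upperDeriv hED hGh hE hs (EuclideanSpace.single i 1)
  have h2 := inner_le_upperDeriv hED hGh hE hs (-EuclideanSpace.single i 1)
  rw [inner_neg_right, EReal.coe_neg, EReal.neg_le] at h2
  rw [← hreg i] at h2
  have h3 := le_antisymm h2 h1
  have h4 : (inner ℝ s (EuclideanSpace.single i (1 : ℝ)) : ℝ) = s i := by
    simp [EuclideanSpace.inner_single_right]
  rw [h4] at h3
  change s i = (upperDeriv G (EuclideanSpace.single i 1) (y, ξ)).toReal
  rw [h3, EReal.toReal_coe]

theorem upperDeriv_of_differentiableAt (hGh : ∀ x ∈ E, G (x, ξ) = h x) (hE : E ∈ 𝓝 y)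
    (hdiff : DifferentiableAt ℝ h y) (v : Vec n) :
    upperDeriv G v (y, ξ) = ((fderiv ℝ h y v : ℝ) : EReal) := by
  refine Tendsto.limsup_eq ?_
  refine (continuous_coe_real_ereal.tendsto _).comp ?_
  have hc : Tendsto (fun m : ℕ => ‖(m : ℝ) + 1‖) atTop atTop :=
    tendsto_norm_atTop_atTop.comp
      (tendsto_atTop_add_const_right _ _ tendsto_natCast_atTop_atTop)
  refine (hdiff.hasFDerivAt.lim v hc).congr' ?_
  filter_upwards [eventually_add_inv_smul_mem hE v] with m hm
  rw [hGh _ hm, hGh _ (mem_of_mem_nhds hE), smul_eq_mul]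

theorem mem_regularSet_of_differentiableAt (hGh : ∀ x ∈ E, G (x, ξ) = h x) (hE : E ∈ 𝓝 y)
    (hdiff : DifferentiableAt ℝ h y) : (y, ξ) ∈ regularSet G := by
  intro i
  rw [upperDeriv_of_differentiableAt hGh hE hdiff, upperDeriv_of_differentiableAt hGh hE hdiff,
    map_neg, EReal.coe_neg, neg_neg]

/-! ### The uniform distribution on the ball -/

theorem isProbabilityMeasure_unifBall (n : ℕ) {ε : ℝ} (hε : 0 < ε) :
    IsProbabilityMeasure (unifBall n ε) :=
  cond_isProbabilityMeasure_of_finite (Metric.measure_closedBall_pos _ _ hε).ne'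
    measure_closedBall_lt_top.ne

theorem unifBall_absolutelyContinuous (n : ℕ) (ε : ℝ) : unifBall n ε ≪ volume :=
  cond_absolutelyContinuous

/-- Spheres are Lebesgue-null. Strictness puts `x + z` in the interior of `enlarge X ε`. -/
theorem ae_unifBall_norm_lt (n : ℕ) {ε : ℝ} (hε : 0 < ε) : ∀ᵐ z ∂(unifBall n ε), ‖z‖ < ε := by
  have h1 : ∀ᵐ z ∂(unifBall n ε), z ∈ Metric.closedBall (0 : Vec n) ε :=
    ae_cond_mem measurableSet_closedBall
  have h2 : ∀ᵐ z ∂(volume : Measure (Vec n)), z ∉ Metric.sphere (0 : Vec n) ε :=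
    measure_eq_zero_iff_ae_notMem.1 (Measure.addHaar_sphere_of_ne_zero _ _ hε.ne')
  filter_upwards [h1, (unifBall_absolutelyContinuous n ε).ae_le h2] with z hz hz'
  rw [mem_closedBall_zero_iff] at hz
  rw [mem_sphere_zero_iff_norm] at hz'
  exact lt_of_le_of_ne hz hz'

theorem map_neg_unifBall (n : ℕ) (ε : ℝ) : (unifBall n ε).map Neg.neg = unifBall n ε := by
  have h1 : ((volume : Measure (Vec n)).restrict (Metric.closedBall 0 ε)).map Neg.neg =
      (volume : Measure (Vec n)).restrict (Metric.closedBall 0 ε) := by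
    have h := (Measure.measurePreserving_neg (volume : Measure (Vec n))).restrict_preimage
      (measurableSet_closedBall (x := (0 : Vec n)) (ε := ε))
    have h2 : (Neg.neg ⁻¹' Metric.closedBall (0 : Vec n) ε) = Metric.closedBall (0 : Vec n) ε := by
      ext z; simp
    rw [h2] at h
    exact h.map_eq
  rw [unifBall, ProbabilityTheory.cond, Measure.map_smul, h1]

theorem mem_enlarge {X : Set (Vec n)} {ε : ℝ} {x z : Vec n} (hx : x ∈ X) (hz : ‖z‖ ≤ ε) :
    x + z ∈ enlarge X ε := ⟨x, hx, z, hz, rfl⟩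

theorem enlarge_mem_nhds {X : Set (Vec n)} {ε : ℝ} {x z : Vec n} (hx : x ∈ X) (hz : ‖z‖ < ε) :
    enlarge X ε ∈ 𝓝 (x + z) := by
  refine Filter.mem_of_superset (Metric.ball_mem_nhds _ (sub_pos.2 hz)) fun y hy => ?_
  refine ⟨x, hx, y - x, ?_, by abel⟩
  rw [Metric.mem_ball, dist_eq_norm] at hy
  have : y - x = (y - (x + z)) + z := by abel
  rw [this]
  exact (norm_add_le _ _).trans (by linarith)

/-- Rademacher: a perturbation of a point of `X` is almost surely a regular point. -/
theorem ae_mem_regularSet {X : Set (Vec n)} {ε : ℝ} (hε : 0 < ε) {C : ℝ}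
    (hGh : ∀ x ∈ enlarge X ε, G (x, ξ) = h x)
    (hLip : ∀ x ∈ enlarge X ε, ∀ y ∈ enlarge X ε, |h x - h y| ≤ C * ‖x - y‖)
    {x : Vec n} (hx : x ∈ X) : ∀ᵐ z ∂(unifBall n ε), (x + z, ξ) ∈ regularSet G := by
  have hL : LipschitzOnWith C.toNNReal h (enlarge X ε) :=
    LipschitzOnWith.of_dist_le' fun a ha b hb => by
      rw [Real.dist_eq, dist_eq_norm]; exact hLip a ha b hb
  -- This gives differentiability only within `enlarge X ε`; it becomes full differentiability
  -- because `x + z` is interior when `‖z‖ < ε`.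
  have h1 := hL.ae_differentiableWithinAt_of_mem (μ := (volume : Measure (Vec n)))
  have h2 := (measurePreserving_add_left (volume : Measure (Vec n)) x).quasiMeasurePreserving.ae h1
  filter_upwards [ae_unifBall_norm_lt n hε, (unifBall_absolutelyContinuous n ε).ae_le h2]
    with z hz hdiff
  have hnhds := enlarge_mem_nhds hx hz
  exact mem_regularSet_of_differentiableAt hGh hnhds
    ((hdiff (mem_enlarge hx hz.le)).differentiableAt hnhds)

end LocalSmoothing

/-! ### Euclidean projection and a deterministic convergence criterion -/

namespace LocalSmoothing

variable {n : ℕ} {X : Set (Vec n)}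

theorem IsProj.inner_le_zero (hX : Convex ℝ X) {v p : Vec n} (hp : IsProj X v p) {w : Vec n}
    (hw : w ∈ X) : inner ℝ (v - p) (w - p) ≤ 0 := by
  refine (norm_eq_iInf_iff_real_inner_le_zero hX hp.1).1 ?_ w hw
  have : Nonempty X := ⟨⟨p, hp.1⟩⟩
  refine le_antisymm (le_ciInf fun w => hp.2 w w.2) ?_
  exact ciInf_le (f := fun w : X => ‖v - w‖) ⟨0, by rintro _ ⟨w, rfl⟩; exact norm_nonneg _⟩ ⟨p, hp.1⟩

/-- Adding the variational inequalities at `p` and `q` gives `‖p - q‖² ≤ ⟪u - v, p - q⟫`;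
Cauchy–Schwarz finishes. -/
theorem IsProj.norm_sub_le (hX : Convex ℝ X) {u v p q : Vec n} (hp : IsProj X u p)
    (hq : IsProj X v q) : ‖p - q‖ ≤ ‖u - v‖ := by
  have h1 := hp.inner_le_zero hX hq.1
  have h2 := hq.inner_le_zero hX hp.1
  have h3 : ‖p - q‖ * ‖p - q‖ ≤ ‖u - v‖ * ‖p - q‖ := by
    calc ‖p - q‖ * ‖p - q‖ = inner ℝ (p - q) (p - q) := (real_inner_self_eq_norm_mul_norm _).symm
      _ = inner ℝ (u - v) (p - q) + inner ℝ (u - p) (q - p) + inner ℝ (v - q) (p - q) := by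
          have e : q - p = -(p - q) := by abel
          rw [e, inner_neg_right, ← sub_eq_add_neg, ← inner_sub_left, ← inner_add_left]
          congr 1; abel
      _ ≤ inner ℝ (u - v) (p - q) := by linarith
      _ ≤ ‖u - v‖ * ‖p - q‖ := real_inner_le_norm _ _
  rcases (norm_nonneg (p - q)).eq_or_lt with h0 | h0
  · rw [← h0]; exact norm_nonneg _
  · exact le_of_mul_le_mul_right h3 h0

theorem isProj_self {y : Vec n} (hy : y ∈ X) : IsProj X y y :=
  ⟨hy, fun w _ => by simp⟩

theorem IsProj.unique (hX : Convex ℝ X) {v p q : Vec n} (hp : IsProj X v p)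
    (hq : IsProj X v q) : p = q := by
  have := hp.norm_sub_le hX hq
  rw [sub_self, norm_zero] at this
  exact sub_eq_zero.1 (norm_le_zero_iff.1 this)

theorem exists_isProj (hne : X.Nonempty) (hcl : IsClosed X) (hX : Convex ℝ X) (v : Vec n) :
    ∃ p, IsProj X v p := by
  obtain ⟨p, hp, hmin⟩ := exists_norm_eq_iInf_of_complete_convex hne hcl.isComplete hX v
  refine ⟨p, hp, fun w hw => ?_⟩
  rw [hmin]
  exact ciInf_le (f := fun w : X => ‖v - w‖) ⟨0, by rintro _ ⟨w, rfl⟩; exact norm_nonneg _⟩ ⟨w, hw⟩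

theorem exists_measurable_proj (hne : X.Nonempty) (hcl : IsClosed X) (hX : Convex ℝ X) :
    ∃ proj : Vec n → Vec n, Measurable proj ∧ ∀ v, IsProj X v (proj v) := by
  choose proj hproj using exists_isProj hne hcl hX
  refine ⟨proj, ?_, hproj⟩
  have : LipschitzWith 1 proj := LipschitzWith.mk_one fun u v => by
    rw [dist_eq_norm, dist_eq_norm]; exact (hproj u).norm_sub_le hX (hproj v)
  exact this.continuous.measurable

/-- One step of the projected subgradient method, measured from a point of `X`. -/
theorem IsProj.norm_sq_le (hX : Convex ℝ X) {v s p y : Vec n} {γ C : ℝ} (hs : ‖s‖ ≤ C)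
    (hp : IsProj X (v - γ • s) p) (hy : y ∈ X) :
    ‖p - y‖ ^ 2 ≤ ‖v - y‖ ^ 2 + 2 * γ * inner ℝ s (y - v) + C ^ 2 * γ ^ 2 := by
  have h1 : ‖p - y‖ ≤ ‖(v - y) - γ • s‖ := by
    have := hp.norm_sub_le hX (isProj_self hy)
    rwa [show v - γ • s - y = (v - y) - γ • s by abel] at this
  have h2 : ‖p - y‖ ^ 2 ≤ ‖(v - y) - γ • s‖ ^ 2 := pow_le_pow_left₀ (norm_nonneg _) h1 2
  rw [norm_sub_sq_real (v - y), inner_smul_right, real_inner_comm, norm_smul, mul_pow, Real.norm_eq_abs,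
    sq_abs] at h2
  have h3 : inner ℝ s (y - v) = -inner ℝ s (v - y) := by rw [← inner_neg_right, neg_sub]
  have h4 : ‖s‖ ^ 2 ≤ C ^ 2 := pow_le_pow_left₀ (norm_nonneg _) hs 2
  have h5 := mul_le_mul_of_nonneg_left h4 (sq_nonneg γ)
  rw [h3]
  linarith

/-- A sequence that converges in distance to all minimizers, with vanishing lower limit of the
optimality gaps, converges to a minimizer. -/
theorem exists_tendsto_of_tendsto_dist {f : Vec n → ℝ} (hcl : IsClosed X)
    (hf : ContinuousOn f X) {S : Set (Vec n)} (hS : S.Nonempty) (hSsub : S ⊆ optSet X f)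
    (hdense : optSet X f ⊆ closure S) {u : ℕ → Vec n} (hu : ∀ k, u k ∈ X)
    (hdist : ∀ y ∈ S, ∃ l, Tendsto (fun k => ‖u k - y‖) atTop (𝓝 l))
    {γ : ℕ → ℝ} (hγ : ∀ k, 0 < γ k) (hγsum : ¬ Summable γ)
    (hsum : ∀ y ∈ S, Summable fun k => γ k * (f (u k) - f y)) :
    ∃ y ∈ optSet X f, Tendsto u atTop (𝓝 y) := by
  obtain ⟨y₀, hy₀⟩ := hS
  obtain ⟨l₀, hl₀⟩ := hdist y₀ hy₀
  have hgap : ∀ k, 0 ≤ f (u k) - f y₀ := fun k => sub_nonneg.2 ((hSsub hy₀).2 _ (hu k))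
  -- If the gap eventually stayed above `δ`, then `γ k` would be dominated by `δ⁻¹` times a summable
  -- sequence.
  have hfreq : ∀ δ > 0, ∃ᶠ k in atTop, f (u k) - f y₀ < δ := by
    intro δ hδ hev
    refine hγsum ?_
    have h1 : Summable fun k => δ⁻¹ * (γ k * (f (u k) - f y₀)) := (hsum y₀ hy₀).mul_left _
    refine Summable.of_norm_bounded_eventually_nat h1 ?_
    filter_upwards [hev] with k hk
    rw [Real.norm_eq_abs, abs_of_pos (hγ k), le_inv_mul_iff₀ hδ]
    nlinarith [hγ k, not_lt.1 hk]
  obtain ⟨φ, hφ, hφlt⟩ := Filter.extraction_forall_of_frequently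
    (fun m : ℕ => hfreq (1 / ((m : ℝ) + 1)) (by positivity))
  have hbdd : Bornology.IsBounded (Set.range u) := by
    obtain ⟨R, hR⟩ := hl₀.bddAbove_range
    refine (Metric.isBounded_closedBall (x := y₀) (r := R)).subset ?_
    rintro _ ⟨k, rfl⟩
    rw [Metric.mem_closedBall, dist_eq_norm]
    exact hR ⟨k, rfl⟩
  obtain ⟨y, -, ψ, hψ, hy⟩ := tendsto_subseq_of_bounded hbdd
    (fun m => Set.mem_range_self (f := u) (φ m))
  have hyX : y ∈ X := hcl.mem_of_tendsto hy (Eventually.of_forall fun m => hu _)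
  have hfy : Tendsto (fun m => f (u (φ (ψ m)))) atTop (𝓝 (f y)) :=
    (hf y hyX).tendsto.comp (tendsto_nhdsWithin_iff.2 ⟨hy, Eventually.of_forall fun m => hu _⟩)
  have hle : f y ≤ f y₀ := by
    have h0 : Tendsto (fun m => f y₀ + 1 / (((ψ m : ℕ) : ℝ) + 1)) atTop (𝓝 (f y₀ + 0)) :=
      tendsto_const_nhds.add (tendsto_one_div_add_atTop_nhds_zero_nat.comp hψ.tendsto_atTop)
    rw [add_zero] at h0
    refine le_of_tendsto_of_tendsto' hfy h0 fun m => ?_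
    have := hφlt (ψ m)
    linarith
  have hyopt : y ∈ optSet X f := ⟨hyX, fun w hw => hle.trans ((hSsub hy₀).2 w hw)⟩
  refine ⟨y, hyopt, ?_⟩
  rw [tendsto_iff_norm_sub_tendsto_zero, Metric.tendsto_atTop]
  intro δ hδ
  -- The cluster point `y` need not lie in `S`. For a nearby `w ∈ S` the full limit of `‖u k - w‖`
  -- exists and, read along the subsequence, equals `‖y - w‖`.
  obtain ⟨w, hw, hwy⟩ := Metric.mem_closure_iff.1 (hdense hyopt) (δ / 4) (by positivity)
  obtain ⟨l, hl⟩ := hdist w hw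
  have hlw : l ≤ δ / 4 := by
    have h1 : Tendsto (fun m => ‖u (φ (ψ m)) - w‖) atTop (𝓝 l) :=
      hl.comp (hφ.tendsto_atTop.comp hψ.tendsto_atTop)
    have h2 : Tendsto (fun m => ‖u (φ (ψ m)) - w‖) atTop (𝓝 ‖y - w‖) := (hy.sub_const w).norm
    rw [tendsto_nhds_unique h1 h2, ← dist_eq_norm]
    exact hwy.le
  obtain ⟨N, hN⟩ := eventually_atTop.1 (hl.eventually_lt_const (show l < δ / 2 by linarith))
  refine ⟨N, fun k hk => ?_⟩
  rw [Real.dist_eq, sub_zero, abs_norm]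
  have h3 : ‖u k - y‖ ≤ ‖u k - w‖ + ‖w - y‖ := norm_sub_le_norm_sub_add_norm_sub _ _ _
  have h4 : ‖w - y‖ < δ / 4 := by rw [← dist_eq_norm, dist_comm]; exact hwy
  linarith [hN k hk]

end LocalSmoothing

/-! ### Almost supermartingales, independence and histories -/

namespace LocalSmoothing

variable {Ω : Type*} {m0 : MeasurableSpace Ω} {P : Measure Ω}

/-- Since `a` is nonnegative, the partial sums of `b` are bounded; the sums can then be subtracted
off. -/
theorem tendsto_of_tendsto_add_sum_sub_sum {a b c : ℕ → ℝ} (ha : ∀ k, 0 ≤ a k)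
    (hb : ∀ k, 0 ≤ b k) (hc : Summable c) {l : ℝ}
    (h : Tendsto (fun k => a k + ∑ j ∈ Finset.range k, b j - ∑ j ∈ Finset.range k, c j)
      atTop (𝓝 l)) : (∃ l', Tendsto a atTop (𝓝 l')) ∧ Summable b := by
  have h1 : Tendsto (fun k => a k + ∑ j ∈ Finset.range k, b j) atTop (𝓝 (l + ∑' j, c j)) := by
    simpa using h.add hc.hasSum.tendsto_sum_nat
  obtain ⟨R, hR⟩ := h1.bddAbove_range
  have hsum : Summable b := summable_of_sum_range_le hb fun k =>
    (le_add_of_nonneg_left (ha k)).trans (hR ⟨k, rfl⟩)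
  refine ⟨⟨l + ∑' j, c j - ∑' j, b j, ?_⟩, hsum⟩
  simpa using h1.sub hsum.hasSum.tendsto_sum_nat

/-- The Robbins–Siegmund almost-supermartingale convergence theorem, with deterministic
perturbations. -/
theorem ae_tendsto_and_summable_of_almost_supermartingale [IsProbabilityMeasure P]
    {ℱ : Filtration ℕ m0} {a b : ℕ → Ω → ℝ} {c : ℕ → ℝ}
    (ha : ∀ k, StronglyMeasurable[ℱ k] (a k)) (hb : ∀ k, StronglyMeasurable[ℱ k] (b k))
    (hai : ∀ k, Integrable (a k) P) (hbi : ∀ k, Integrable (b k) P)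
    (ha0 : ∀ k, 0 ≤ᵐ[P] a k) (hb0 : ∀ k, 0 ≤ᵐ[P] b k) (hc0 : ∀ k, 0 ≤ c k) (hc : Summable c)
    (hstep : ∀ k (A : Set Ω), MeasurableSet[ℱ k] A →
      ∫ ω in A, a (k + 1) ω ∂P + ∫ ω in A, b k ω ∂P ≤ ∫ ω in A, a k ω ∂P + ∫ _ in A, c k ∂P) :
    ∀ᵐ ω ∂P, (∃ l, Tendsto (fun k => a k ω) atTop (𝓝 l)) ∧ Summable fun k => b k ω := by
  -- Crediting the accumulated `b` and removing the accumulated `c` gives a true supermartingale.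
  let V : ℕ → Ω → ℝ := fun k ω =>
    a k ω + ∑ j ∈ Finset.range k, b j ω - ∑ j ∈ Finset.range k, c j
  have hbsum : ∀ k, Integrable (fun ω => ∑ j ∈ Finset.range k, b j ω) P := fun k =>
    integrable_finsetSum _ fun j _ => hbi j
  have hVi : ∀ k, Integrable (V k) P := fun k =>
    ((hai k).add (hbsum k)).sub (integrable_const _)
  have hVm : StronglyAdapted ℱ V := fun k => by
    refine ((ha k).add ?_).sub stronglyMeasurable_const
    exact Finset.stronglyMeasurable_fun_sum _ fun j hj =>
      (hb j).mono (ℱ.mono (Finset.mem_range.1 hj).le)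
  have hdiff : ∀ k ω, V (k + 1) ω = V k ω + (a (k + 1) ω + b k ω - a k ω - c k) := fun k ω => by
    simp only [V, Finset.sum_range_succ]; ring
  have hVstep : ∀ k (A : Set Ω), MeasurableSet[ℱ k] A →
      ∫ ω in A, V (k + 1) ω ∂P ≤ ∫ ω in A, V k ω ∂P := fun k A hA => by
    have e1 : ∫ ω in A, V (k + 1) ω ∂P = ∫ ω in A, V k ω ∂P +
        (∫ ω in A, a (k + 1) ω ∂P + ∫ ω in A, b k ω ∂P - ∫ ω in A, a k ω ∂P
          - ∫ _ in A, c k ∂P) := by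
      simp_rw [hdiff]
      have i1 := (hai (k + 1)).restrict (s := A)
      have i2 := (hbi k).restrict (s := A)
      have i3 := (hai k).restrict (s := A)
      have i4 : Integrable (fun _ => c k) (P.restrict A) := integrable_const _
      have i12 : Integrable (fun ω => a (k + 1) ω + b k ω) (P.restrict A) := i1.add i2
      have i123 : Integrable (fun ω => a (k + 1) ω + b k ω - a k ω) (P.restrict A) := i12.sub i3
      have i1234 : Integrable (fun ω => a (k + 1) ω + b k ω - a k ω - c k) (P.restrict A) :=
        i123.sub i4
      rw [integral_add (hVi k).restrict i1234, integral_sub i123 i4, integral_sub i12 i3,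
        integral_add i1 i2]
    have := hstep k A hA
    linarith
  have hsup : Supermartingale V ℱ P := supermartingale_of_setIntegral_succ_le hVm hVi hVstep
  have hVint : ∀ k, ∫ ω, V k ω ∂P ≤ ∫ ω, a 0 ω ∂P := fun k => by
    induction k with
    | zero => simp [V]
    | succ k ih =>
      have := hVstep k Set.univ MeasurableSet.univ
      simp only [Measure.restrict_univ] at this
      exact this.trans ih
  -- `V` is bounded below by `-∑' j, c j`, so its upper mean bound gives the `L¹` bound needed for
  -- Doob's theorem.
  have habs : ∀ k, ∀ᵐ ω ∂P, ‖(-V) k ω‖ ≤ V k ω + 2 * ∑' j, c j := fun k => by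
    have hb' : ∀ᵐ ω ∂P, ∀ j, 0 ≤ b j ω := ae_all_iff.2 hb0
    filter_upwards [ha0 k, hb'] with ω h1 h2
    have h3 : ∑ j ∈ Finset.range k, c j ≤ ∑' j, c j := hc.sum_le_tsum _ fun j _ => hc0 j
    have h4 : 0 ≤ ∑ j ∈ Finset.range k, b j ω := Finset.sum_nonneg fun j _ => h2 j
    have h5 : 0 ≤ ∑ j ∈ Finset.range k, c j := Finset.sum_nonneg fun j _ => hc0 j
    have h6 : (0 : ℝ) ≤ a k ω := h1
    simp only [Pi.neg_apply, norm_neg, Real.norm_eq_abs, V]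
    rw [abs_le]
    constructor <;> linarith
  have hnorm : ∀ k, eLpNorm ((-V) k) 1 P ≤
      ((∫ ω, a 0 ω ∂P + 2 * ∑' j, c j).toNNReal : ENNReal) := fun k => by
    have hi : Integrable (fun ω => V k ω + 2 * ∑' j, c j) P := (hVi k).add (integrable_const _)
    have hneg : Integrable ((-V) k) P := (hVi k).neg
    rw [eLpNorm_one_eq_lintegral_enorm, ← ofReal_integral_norm_eq_lintegral_enorm hneg]
    refine ENNReal.ofReal_le_ofReal ((integral_mono_ae hneg.norm hi (habs k)).trans ?_)
    rw [integral_add (hVi k) (integrable_const _)]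
    simpa using hVint k
  filter_upwards [hsup.neg.exists_ae_tendsto_of_bdd hnorm, ae_all_iff.2 ha0, ae_all_iff.2 hb0]
    with ω ⟨l, hl⟩ h1 h2
  refine tendsto_of_tendsto_add_sum_sub_sum h1 h2 hc (l := -l) ?_
  simpa [V] using hl.neg

/-- Integrating out a variable that is independent of the past. -/
theorem setIntegral_comp_eq_of_indep {Ω : Type*} {m m0 : MeasurableSpace Ω} {P : Measure Ω}
    [IsProbabilityMeasure P] {α β : Type*} [MeasurableSpace α] [MeasurableSpace β]
    (hm : m ≤ m0) {Z : Ω → β} (hZ : Measurable Z)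
    (hind : Indep m (MeasurableSpace.comap Z inferInstance) P) {Y : Ω → α}
    (hY : Measurable[m] Y) {A : Set Ω} (hA : MeasurableSet[m] A) {Φ : α × β → ℝ}
    (hΦ : Measurable Φ) (hint : Integrable (fun ω => Φ (Y ω, Z ω)) P) :
    ∫ ω in A, Φ (Y ω, Z ω) ∂P = ∫ ω in A, (∫ ζ, Φ (Y ω, ζ) ∂(P.map Z)) ∂P := by
  have hY0 : Measurable Y := hY.mono hm le_rfl
  have : IsProbabilityMeasure (P.map Z) := Measure.isProbabilityMeasure_map hZ.aemeasurable
  -- Restricting to `A` keeps the product form, because `Y ⁻¹' s ∩ A` is still an event of `m`.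
  have hprod : ((P.restrict A).map Y).prod (P.map Z) =
      (P.restrict A).map (fun ω => (Y ω, Z ω)) := by
    refine Measure.prod_eq fun s t hs ht => ?_
    rw [Measure.map_apply (hY0.prodMk hZ) (hs.prod ht), Measure.map_apply hY0 hs,
      Measure.map_apply hZ ht, Measure.restrict_apply' (hm _ hA), Measure.restrict_apply' (hm _ hA)]
    have h1 := (Indep_iff _ _ P).1 hind (Y ⁻¹' s ∩ A) (Z ⁻¹' t) ((hY hs).inter hA) ⟨t, ht, rfl⟩
    rw [← h1]
    congr 1
    ext ω
    simp only [Set.mem_inter_iff, Set.mem_preimage, Set.mem_prod]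
    tauto
  have hint' : Integrable Φ ((P.restrict A).map (fun ω => (Y ω, Z ω))) :=
    (integrable_map_measure hΦ.aestronglyMeasurable (hY0.prodMk hZ).aemeasurable).2 hint.restrict
  calc ∫ ω in A, Φ (Y ω, Z ω) ∂P
      = ∫ p, Φ p ∂((P.restrict A).map (fun ω => (Y ω, Z ω))) :=
        (integral_map (hY0.prodMk hZ).aemeasurable hΦ.aestronglyMeasurable).symm
    _ = ∫ y, (∫ ζ, Φ (y, ζ) ∂(P.map Z)) ∂((P.restrict A).map Y) := by
        rw [← hprod] at hint' ⊢
        exact integral_prod _ hint'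
    _ = _ := by
        rw [integral_map hY0.aemeasurable]
        exact hΦ.stronglyMeasurable.integral_prod_right'.aestronglyMeasurable

/-- The joint law is a product, so Fubini for null sets allows the exceptional set of `ζ` to vary
with `Y ω`. -/
theorem ae_comp_of_indep {Ω : Type*} {m m0 : MeasurableSpace Ω} {P : Measure Ω}
    [IsProbabilityMeasure P] {α β : Type*} [MeasurableSpace α] [MeasurableSpace β]
    (hm : m ≤ m0) {Z : Ω → β} (hZ : Measurable Z)
    (hind : Indep m (MeasurableSpace.comap Z inferInstance) P) {Y : Ω → α}
    (hY : Measurable[m] Y) {Q : Set (α × β)} (hQ : MeasurableSet Q)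
    (h : ∀ᵐ ω ∂P, ∀ᵐ ζ ∂(P.map Z), (Y ω, ζ) ∈ Q) : ∀ᵐ ω ∂P, (Y ω, Z ω) ∈ Q := by
  have hY0 : Measurable Y := hY.mono hm le_rfl
  have hI : IndepFun Y Z P := indep_of_indep_of_le_left hind hY.comap_le
  have hmap := (indepFun_iff_map_prod_eq_prod_map_map hY0.aemeasurable hZ.aemeasurable).1 hI
  have : IsProbabilityMeasure (P.map Z) := Measure.isProbabilityMeasure_map hZ.aemeasurable
  refine ae_of_ae_map (p := fun q => q ∈ Q) (hY0.prodMk hZ).aemeasurable ?_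
  rw [hmap, Measure.ae_prod_mem_iff_ae_ae_mem hQ]
  rw [ae_map_iff hY0.aemeasurable]
  · exact h
  · exact measurable_measure_prodMk_left hQ.compl (measurableSet_singleton 0)

/-- The history generated by an initial value and the first `k` samples. -/
def history {α β : Type*} (x₀ : Ω → α) (Z : ℕ → Ω → β) (k : ℕ) (ω : Ω) :
    α × (Finset.range k → β) :=
  (x₀ ω, fun j => Z j ω)

variable {α β : Type*} [MeasurableSpace α] [MeasurableSpace β] {x₀ : Ω → α} {Z : ℕ → Ω → β}

theorem measurable_history (hx₀ : Measurable x₀) (hZ : ∀ k, Measurable (Z k)) (k : ℕ) :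
    Measurable (history x₀ Z k) :=
  hx₀.prodMk (measurable_pi_lambda _ fun j => hZ j)

/-- The filtration generated by the history. -/
def historyFiltration (hx₀ : Measurable x₀) (hZ : ∀ k, Measurable (Z k)) : Filtration ℕ m0 where
  seq k := MeasurableSpace.comap (history x₀ Z k) inferInstance
  mono' := by
    intro i j hij
    let r : α × (Finset.range j → β) → α × (Finset.range i → β) := fun p =>
      (p.1, fun l => p.2 ⟨l, Finset.mem_range.2 ((Finset.mem_range.1 l.2).trans_le hij)⟩)
    have hr : Measurable r := by
      refine measurable_fst.prodMk (measurable_pi_lambda _ fun l => ?_)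
      exact (measurable_pi_apply _).comp measurable_snd
    have hcomp : history x₀ Z i = r ∘ history x₀ Z j := rfl
    change MeasurableSpace.comap (history x₀ Z i) _ ≤ _
    rw [hcomp, ← MeasurableSpace.comap_comp]
    exact MeasurableSpace.comap_mono hr.comap_le
  le' k := (measurable_history hx₀ hZ k).comap_le

theorem measurable_init_historyFiltration (hx₀ : Measurable x₀) (hZ : ∀ k, Measurable (Z k)) :
    Measurable[historyFiltration hx₀ hZ 0] x₀ :=
  measurable_fst.comp (comap_measurable (history x₀ Z 0))

theorem measurable_sample_historyFiltration (hx₀ : Measurable x₀) (hZ : ∀ k, Measurable (Z k))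
    (k : ℕ) : Measurable[historyFiltration hx₀ hZ (k + 1)] (Z k) :=
  ((measurable_pi_apply (⟨k, Finset.self_mem_range_succ k⟩ : Finset.range (k + 1))).comp
    measurable_snd).comp (comap_measurable (history x₀ Z (k + 1)))

/-- The two independence hypotheses make the law of `(x₀, (B, Z k))` a triple product; reassociating
it separates `(x₀, B)` from `Z k`. -/
theorem indep_historyFiltration [IsProbabilityMeasure P] (hx₀ : Measurable x₀)
    (hZ : ∀ k, Measurable (Z k)) (hZind : iIndepFun Z P)
    (hx₀ind : IndepFun x₀ (fun ω k => Z k ω) P) (k : ℕ) :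
    Indep (historyFiltration hx₀ hZ k) (MeasurableSpace.comap (Z k) inferInstance) P := by
  let B : Ω → (Finset.range k → β) := fun ω j => Z j ω
  have hB : Measurable B := measurable_pi_lambda _ fun j => hZ j
  have h1 : IndepFun B (Z k) P := by
    have h := hZind.indepFun_finset (Finset.range k) {k} (by simp) hZ
    exact h.comp (φ := id) (ψ := fun f : ({k} : Finset ℕ) → β => f ⟨k, Finset.mem_singleton_self k⟩)
      measurable_id (measurable_pi_apply (⟨k, Finset.mem_singleton_self k⟩ : ({k} : Finset ℕ)))
  have h2 : IndepFun x₀ (fun ω => (B ω, Z k ω)) P := by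
    refine hx₀ind.comp (φ := id) (ψ := fun f : ℕ → β => ((fun j : Finset.range k => f j), f k))
      measurable_id ?_
    exact (measurable_pi_lambda _ fun j => measurable_pi_apply _).prodMk (measurable_pi_apply _)
  change IndepFun (fun ω => (x₀ ω, B ω)) (Z k) P
  have := Measure.isProbabilityMeasure_map (μ := P) hx₀.aemeasurable
  have := Measure.isProbabilityMeasure_map (μ := P) hB.aemeasurable
  have := Measure.isProbabilityMeasure_map (μ := P) (hZ k).aemeasurable
  have e1 := (indepFun_iff_map_prod_eq_prod_map_map hB.aemeasurable (hZ k).aemeasurable).1 h1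
  have e2 := (indepFun_iff_map_prod_eq_prod_map_map hx₀.aemeasurable
    (hB.prodMk (hZ k)).aemeasurable).1 h2
  have h3 : IndepFun x₀ B P := h2.comp (φ := id) (ψ := Prod.fst) measurable_id measurable_fst
  have e3 := (indepFun_iff_map_prod_eq_prod_map_map hx₀.aemeasurable hB.aemeasurable).1 h3
  rw [indepFun_iff_map_prod_eq_prod_map_map (hx₀.prodMk hB).aemeasurable (hZ k).aemeasurable, e3]
  rw [e1] at e2
  have e4 := (measurePreserving_prodAssoc (P.map x₀) (P.map B) (P.map (Z k))).symm
  rw [← e4.map_eq, ← e2, Measure.map_map (MeasurableEquiv.measurable _)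
    (hx₀.prodMk (hB.prodMk (hZ k)))]
  rfl

end LocalSmoothing

/-! ### The smoothed objective against the original one -/

namespace LocalSmoothing

variable {n d : ℕ}

/-- A jointly measurable `G` that represents the integrand `F` on `enlarge X ε` for almost every
parameter, together with the almost sure Lipschitz and subgradient bounds for `F`. -/
structure IsSurrogate (D X : Set (Vec n)) (F : Vec n → Vec d → ℝ) (ν : Measure (Vec d))
    (ε C : ℝ) (G : Vec n × Vec d → ℝ) : Prop where
  measurable : Measurable G
  ae_eq : ∀ᵐ ξ ∂ν, ∀ y ∈ enlarge X ε, G (y, ξ) = F y ξ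
  ae_lipschitz : ∀ᵐ ξ ∂ν, ∀ x ∈ enlarge X ε, ∀ y ∈ enlarge X ε, |F x ξ - F y ξ| ≤ C * ‖x - y‖
  ae_subdiff_bound : ∀ᵐ ξ ∂ν, ∀ x ∈ enlarge X ε, ∀ s ∈ subdiff D (fun y => F y ξ) x, ‖s‖ ≤ C
  ae_subdiff_nonempty : ∀ᵐ ξ ∂ν, ∀ x ∈ enlarge X ε, (subdiff D (fun y => F y ξ) x).Nonempty

theorem exists_isSurrogate {D X : Set (Vec n)} {ε : ℝ} (hε : 0 < ε) (hD : IsOpen D)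
    (hXne : X.Nonempty) (hXD : enlarge X ε ⊆ D) {Ω : Set (Vec d)} {ν : Measure (Vec d)}
    (hΩ : ∀ᵐ ξ ∂ν, ξ ∈ Ω) {F : Vec n → Vec d → ℝ}
    (hFconv : ∀ ξ ∈ Ω, ConvexOn ℝ D (fun x => F x ξ)) (hFint : ∀ x ∈ D, Integrable (F x) ν)
    {C : ℝ} (hC : ∀ x ∈ enlarge X ε, ∀ ξ ∈ Ω, ∀ s ∈ subdiff D (fun y => F y ξ) x, ‖s‖ ≤ C) :
    ∃ G, IsSurrogate D X F ν ε C G := by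
  have hLip : ∀ᵐ ξ ∂ν, ∀ x ∈ enlarge X ε, ∀ y ∈ enlarge X ε, |F x ξ - F y ξ| ≤ C * ‖x - y‖ := by
    filter_upwards [hΩ] with ξ hξ x hx y hy
    exact abs_sub_le_of_subdiff_bound hD hXD (hFconv ξ hξ) (fun x hx => hC x hx ξ hξ) hx hy
  obtain ⟨x, hx⟩ := hXne
  obtain ⟨G, hG, hGF⟩ := exists_measurable_extension
    ⟨x + 0, mem_enlarge hx (by simpa using hε.le)⟩
    (fun y hy => (hFint y (hXD hy)).aestronglyMeasurable) hLip
  refine ⟨G, hG, hGF, hLip, ?_, ?_⟩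
  · filter_upwards [hΩ] with ξ hξ x hx
    exact hC x hx ξ hξ
  · filter_upwards [hΩ] with ξ hξ x hx
    exact subdiff_nonempty hD (hFconv ξ hξ) (hXD hx)

theorem mem_enlarge_self {X : Set (Vec n)} {ε : ℝ} (hε : 0 < ε) {x : Vec n} (hx : x ∈ X) :
    x ∈ enlarge X ε := by
  simpa using mem_enlarge (ε := ε) hx (z := 0) (by simpa using hε.le)

namespace IsSurrogate

variable {D X : Set (Vec n)} {F : Vec n → Vec d → ℝ} {ν : Measure (Vec d)} {ε C : ℝ}
  {G : Vec n × Vec d → ℝ}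

theorem const_nonneg (hG : IsSurrogate D X F ν ε C G) (hε : 0 < ε) (hXne : X.Nonempty)
    [IsProbabilityMeasure ν] : 0 ≤ C := by
  obtain ⟨x, hx⟩ := hXne
  obtain ⟨ξ, h1, h2⟩ := (hG.ae_subdiff_bound.and hG.ae_subdiff_nonempty).exists
  obtain ⟨s, hs⟩ := h2 x (mem_enlarge_self hε hx)
  exact (norm_nonneg s).trans (h1 x (mem_enlarge_self hε hx) s hs)

theorem ae_norm_lt (hε : 0 < ε) [SFinite ν] :
    ∀ᵐ p ∂((unifBall n ε).prod ν), ‖p.1‖ < ε :=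
  Measure.quasiMeasurePreserving_fst.ae (ae_unifBall_norm_lt n hε)

theorem ae_prod_eq (hG : IsSurrogate D X F ν ε C G) (hε : 0 < ε) [SFinite ν] {x : Vec n}
    (hx : x ∈ X) : ∀ᵐ p ∂((unifBall n ε).prod ν), G (x + p.1, p.2) = F (x + p.1) p.2 := by
  filter_upwards [ae_norm_lt hε, Measure.quasiMeasurePreserving_snd.ae hG.ae_eq] with p h1 h2
  exact h2 _ (mem_enlarge hx h1.le)

theorem ae_prod_abs_sub_le (hG : IsSurrogate D X F ν ε C G) (hε : 0 < ε) [SFinite ν]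
    {x : Vec n} (hx : x ∈ X) (hC : 0 ≤ C) :
    ∀ᵐ p ∂((unifBall n ε).prod ν), |F (x + p.1) p.2 - F x p.2| ≤ ε * C := by
  filter_upwards [ae_norm_lt hε, Measure.quasiMeasurePreserving_snd.ae hG.ae_lipschitz]
    with p h1 h2
  refine (h2 _ (mem_enlarge hx h1.le) _ (mem_enlarge_self hε hx)).trans ?_
  rw [add_sub_cancel_left, mul_comm]
  exact mul_le_mul_of_nonneg_right h1.le hC

variable [IsProbabilityMeasure ν]

/-- Joint measurability is borrowed from `G`, and `|F x ξ| + ε * C` dominates. -/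
theorem integrable_prod (hG : IsSurrogate D X F ν ε C G) (hε : 0 < ε) (hC : 0 ≤ C) {x : Vec n}
    (hx : x ∈ X) (hFx : Integrable (F x) ν) :
    Integrable (fun p : Vec n × Vec d => F (x + p.1) p.2) ((unifBall n ε).prod ν) := by
  have := isProbabilityMeasure_unifBall n hε
  have hm : AEStronglyMeasurable (fun p : Vec n × Vec d => F (x + p.1) p.2)
      ((unifBall n ε).prod ν) := by
    have h1 : Measurable fun p : Vec n × Vec d => G (x + p.1, p.2) :=
      hG.measurable.comp (by fun_prop)
    exact h1.aestronglyMeasurable.congr (hG.ae_prod_eq hε hx)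
  have hdom : Integrable (fun p : Vec n × Vec d => |F x p.2| + ε * C) ((unifBall n ε).prod ν) :=
    (hFx.comp_snd (unifBall n ε)).abs.add (integrable_const _)
  refine hdom.mono' hm ?_
  filter_upwards [hG.ae_prod_abs_sub_le hε hx hC] with p hp
  rw [Real.norm_eq_abs]
  have := abs_sub_abs_le_abs_sub (F (x + p.1) p.2) (F x p.2)
  linarith

theorem smoothObjective_eq (hG : IsSurrogate D X F ν ε C G) (hε : 0 < ε) (hC : 0 ≤ C)
    {x : Vec n} (hx : x ∈ X) (hFx : Integrable (F x) ν) :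
    smoothObjective F ν ε x = ∫ p, F (x + p.1) p.2 ∂((unifBall n ε).prod ν) := by
  have := isProbabilityMeasure_unifBall n hε
  exact (integral_prod_symm _ (hG.integrable_prod hε hC hx hFx)).symm

theorem objective_eq (hε : 0 < ε) {x : Vec n} :
    objective F ν x = ∫ p, F x p.2 ∂((unifBall n ε).prod ν) := by
  have := isProbabilityMeasure_unifBall n hε
  rw [integral_fun_snd]
  simp [objective]

theorem smoothObjective_le (hG : IsSurrogate D X F ν ε C G) (hε : 0 < ε) (hC : 0 ≤ C)
    {x : Vec n} (hx : x ∈ X) (hFx : Integrable (F x) ν) :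
    smoothObjective F ν ε x ≤ objective F ν x + ε * C := by
  have := isProbabilityMeasure_unifBall n hε
  have hi : Integrable (fun p : Vec n × Vec d => F x p.2) ((unifBall n ε).prod ν) :=
    hFx.comp_snd (unifBall n ε)
  have h1 : objective F ν x + ε * C = ∫ p, (F x p.2 + ε * C) ∂((unifBall n ε).prod ν) := by
    rw [integral_add hi (integrable_const _), ← objective_eq hε]
    simp
  rw [hG.smoothObjective_eq hε hC hx hFx, h1]
  refine integral_mono_ae (hG.integrable_prod hε hC hx hFx) (hi.add (integrable_const _)) ?_
  filter_upwards [hG.ae_prod_abs_sub_le hε hx hC] with p hp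
  have := (abs_le.1 hp).2
  change F (x + p.1) p.2 ≤ F x p.2 + ε * C
  linarith

/-- Smoothing over a symmetric distribution does not decrease the value at a point where there is
a subgradient. -/
theorem le_smoothF (hε : 0 < ε) (hXD : enlarge X ε ⊆ D) {x : Vec n} (hx : x ∈ X) {ξ : Vec d}
    (hsub : (subdiff D (fun y => F y ξ) x).Nonempty)
    (hint : Integrable (fun z => F (x + z) ξ) (unifBall n ε)) :
    F x ξ ≤ smoothF F ε x ξ := by
  have := isProbabilityMeasure_unifBall n hε
  obtain ⟨s, hs⟩ := hsub
  have hneg : MeasurePreserving (MeasurableEquiv.neg (Vec n)) (unifBall n ε) (unifBall n ε) :=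
    ⟨measurable_neg, map_neg_unifBall n ε⟩
  have hint' : Integrable (fun z => F (x + -z) ξ) (unifBall n ε) :=
    (hneg.integrable_comp_emb (MeasurableEquiv.measurableEmbedding _)).2 hint
  have heq : ∫ z, F (x + -z) ξ ∂(unifBall n ε) = smoothF F ε x ξ :=
    hneg.integral_comp' fun z => F (x + z) ξ
  -- Pairing `z` with `-z` cancels the linear terms of the subgradient inequality.
  have h1 : ∫ z, (F x ξ + F x ξ) ∂(unifBall n ε) ≤
      ∫ z, (F (x + z) ξ + F (x + -z) ξ) ∂(unifBall n ε) := by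
    refine integral_mono_ae (integrable_const _) (hint.add hint') ?_
    filter_upwards [ae_unifBall_norm_lt n hε] with z hz
    have h2 := hs _ (hXD (mem_enlarge hx hz.le))
    have h3 := hs _ (hXD (mem_enlarge (ε := ε) (z := -z) hx (by rw [norm_neg]; exact hz.le)))
    rw [add_sub_cancel_left] at h2 h3
    rw [inner_neg_right] at h3
    change F x ξ + F x ξ ≤ F (x + z) ξ + F (x + -z) ξ
    linarith
  rw [integral_add hint hint', heq] at h1
  have h4 : ∫ z, F (x + z) ξ ∂(unifBall n ε) = smoothF F ε x ξ := rfl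
  rw [h4] at h1
  simp at h1
  linarith

theorem objective_le (hG : IsSurrogate D X F ν ε C G) (hε : 0 < ε) (hC : 0 ≤ C)
    (hXD : enlarge X ε ⊆ D) {x : Vec n} (hx : x ∈ X) (hFx : Integrable (F x) ν) :
    objective F ν x ≤ smoothObjective F ν ε x := by
  have := isProbabilityMeasure_unifBall n hε
  have hi := hG.integrable_prod hε hC hx hFx
  refine integral_mono_ae hFx hi.integral_prod_right ?_
  filter_upwards [hG.ae_subdiff_nonempty, hi.prod_left_ae] with ξ h1 h2
  exact le_smoothF hε hXD hx (h1 x (mem_enlarge_self hε hx)) h2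

theorem ae_prod_abs_sub_le' (hG : IsSurrogate D X F ν ε C G) (hε : 0 < ε) {x y : Vec n}
    (hx : x ∈ X) (hy : y ∈ X) :
    ∀ᵐ p ∂((unifBall n ε).prod ν), |G (x + p.1, p.2) - G (y + p.1, p.2)| ≤ C * ‖x - y‖ := by
  filter_upwards [ae_norm_lt hε, Measure.quasiMeasurePreserving_snd.ae hG.ae_lipschitz,
    hG.ae_prod_eq hε hx, hG.ae_prod_eq hε hy] with p h1 h2 h3 h4
  rw [h3, h4]
  simpa using h2 _ (mem_enlarge hx h1.le) _ (mem_enlarge hy h1.le)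

theorem smoothObjective_sub (hG : IsSurrogate D X F ν ε C G) (hε : 0 < ε) (hC : 0 ≤ C)
    {x y : Vec n} (hx : x ∈ X) (hy : y ∈ X) (hFx : Integrable (F x) ν)
    (hFy : Integrable (F y) ν) :
    ∫ p, (G (x + p.1, p.2) - G (y + p.1, p.2)) ∂((unifBall n ε).prod ν) =
      smoothObjective F ν ε x - smoothObjective F ν ε y := by
  rw [hG.smoothObjective_eq hε hC hx hFx, hG.smoothObjective_eq hε hC hy hFy,
    ← integral_sub (hG.integrable_prod hε hC hx hFx) (hG.integrable_prod hε hC hy hFy)]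
  refine integral_congr_ae ?_
  filter_upwards [hG.ae_prod_eq hε hx, hG.ae_prod_eq hε hy] with p h1 h2
  rw [h1, h2]

theorem abs_smoothObjective_sub_le (hG : IsSurrogate D X F ν ε C G) (hε : 0 < ε) (hC : 0 ≤ C)
    {x y : Vec n} (hx : x ∈ X) (hy : y ∈ X) (hFx : Integrable (F x) ν)
    (hFy : Integrable (F y) ν) :
    |smoothObjective F ν ε x - smoothObjective F ν ε y| ≤ C * ‖x - y‖ := by
  have := isProbabilityMeasure_unifBall n hε
  rw [← hG.smoothObjective_sub hε hC hx hy hFx hFy]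
  have hle : ∀ᵐ p ∂((unifBall n ε).prod ν),
      ‖G (x + p.1, p.2) - G (y + p.1, p.2)‖ ≤ C * ‖x - y‖ := hG.ae_prod_abs_sub_le' hε hx hy
  simpa using norm_integral_le_of_norm_le_const hle

theorem continuousOn_smoothObjective (hG : IsSurrogate D X F ν ε C G) (hε : 0 < ε) (hC : 0 ≤ C)
    (hFint : ∀ x ∈ X, Integrable (F x) ν) : ContinuousOn (smoothObjective F ν ε) X := by
  refine (LipschitzOnWith.of_dist_le' (K := C) fun x hx y hy => ?_).continuousOn
  rw [Real.dist_eq, dist_eq_norm]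
  exact hG.abs_smoothObjective_sub_le hε hC hx hy (hFint x hx) (hFint y hy)

end IsSurrogate

theorem optValue_mono {X : Set (Vec n)} {f g : Vec n → ℝ} (h : ∀ x ∈ X, f x ≤ g x) :
    optValue X f ≤ optValue X g :=
  iInf₂_mono fun x hx => EReal.coe_le_coe_iff.2 (h x hx)

theorem optValue_le_add {X : Set (Vec n)} {f g : Vec n → ℝ} {c : ℝ}
    (h : ∀ x ∈ X, g x ≤ f x + c) : optValue X g ≤ optValue X f + (c : EReal) := by
  -- Moving the finite `c` to the left leaves a bare infimum on the right, to be tested pointwise;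
  -- the value `-∞` is allowed.
  rw [← EReal.sub_le_iff_le_add (by simp) (by simp)]
  refine le_iInf₂ fun x hx => ?_
  rw [EReal.sub_le_iff_le_add (by simp) (by simp), ← EReal.coe_add]
  exact (iInf₂_le x hx).trans (EReal.coe_le_coe_iff.2 (h x hx))

end LocalSmoothing

/-! ### Almost sure convergence of the stochastic subgradient method -/

namespace LocalSmoothing

variable {n d : ℕ} {W : Type*} [MeasurableSpace W] {P : Measure W}

/-- The adapted version of the subgradient method, in which the subgradient is the upper gradient
of the surrogate integrand. -/
noncomputable def adaptedRun (proj : Vec n → Vec n) (γ : ℕ → ℝ) (G : Vec n × Vec d → ℝ)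
    (x₀ : W → Vec n) (Z : ℕ → W → Vec n × Vec d) : ℕ → W → Vec n
  | 0 => x₀
  | k + 1 => fun ω => proj (adaptedRun proj γ G x₀ Z k ω -
      γ k • upperGrad G (adaptedRun proj γ G x₀ Z k ω + (Z k ω).1, (Z k ω).2))

/-- Iterate `k` uses only samples of index below `k`, which leaves sample `k` free to be independent
of it. -/
theorem measurable_adaptedRun {proj : Vec n → Vec n} (hproj : Measurable proj) (γ : ℕ → ℝ)
    {G : Vec n × Vec d → ℝ} (hG : Measurable G) {x₀ : W → Vec n} (hx₀ : Measurable x₀)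
    {Z : ℕ → W → Vec n × Vec d} (hZ : ∀ k, Measurable (Z k)) (k : ℕ) :
    Measurable[historyFiltration hx₀ hZ k] (adaptedRun proj γ G x₀ Z k) := by
  induction k with
  | zero => exact measurable_init_historyFiltration hx₀ hZ
  | succ k ih =>
    have h1 : Measurable[historyFiltration hx₀ hZ (k + 1)] (adaptedRun proj γ G x₀ Z k) :=
      ih.mono ((historyFiltration hx₀ hZ).mono k.le_succ) le_rfl
    have h2 := measurable_sample_historyFiltration hx₀ hZ k
    let u : Vec n × (Vec n × Vec d) → Vec n := fun q =>
      proj (q.1 - γ k • upperGrad G (q.1 + q.2.1, q.2.2))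
    have hu : Measurable u := by
      refine hproj.comp (measurable_fst.sub (Measurable.const_smul ?_ (γ k)))
      exact (measurable_upperGrad hG).comp (by fun_prop)
    exact hu.comp (h1.prodMk h2)

section Run

variable {D X : Set (Vec n)} {F : Vec n → Vec d → ℝ} {ν : Measure (Vec d)} {ε C : ℝ}
  {γ : ℕ → ℝ} {x z s : ℕ → W → Vec n} {ξ : ℕ → W → Vec d} {G : Vec n × Vec d → ℝ}
  {proj : Vec n → Vec n}

theorem IsRun.measurable_sample (hrun : IsRun D X F ν ε γ P x z s ξ) (k : ℕ) :
    Measurable fun ω => (z k ω, ξ k ω) :=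
  (hrun.measurable_z k).prodMk (hrun.measurable_xi k)

theorem IsRun.ae_sample (hrun : IsRun D X F ν ε γ P x z s ξ) {p : Vec n × Vec d → Prop}
    (hp : ∀ᵐ q ∂((unifBall n ε).prod ν), p q) (k : ℕ) : ∀ᵐ ω ∂P, p (z k ω, ξ k ω) := by
  rw [← hrun.law_sample k] at hp
  exact ae_of_ae_map (hrun.measurable_sample k).aemeasurable hp

variable [IsProbabilityMeasure ν]

/-- The randomization makes the subgradient unique: if the iterate agrees almost surely with a
point of `X` that is determined by the history, then the subgradient is the upper gradient. -/
theorem IsRun.ae_eq_upperGrad [IsProbabilityMeasure P]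
    (hrun : IsRun D X F ν ε γ P x z s ξ)
    (hG : IsSurrogate D X F ν ε C G) (hε : 0 < ε) (hXD : enlarge X ε ⊆ D) (k : ℕ)
    {y : W → Vec n}
    (hy : Measurable[historyFiltration hrun.measurable_init hrun.measurable_sample k] y)
    (hyX : ∀ᵐ ω ∂P, y ω ∈ X) (hxy : ∀ᵐ ω ∂P, x k ω = y ω) :
    ∀ᵐ ω ∂P, s k ω = upperGrad G (y ω + z k ω, ξ k ω) := by
  have := isProbabilityMeasure_unifBall n hε
  let Q : Set (Vec n × (Vec n × Vec d)) := {q | (q.1 + q.2.1, q.2.2) ∈ regularSet G}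
  have hQ : MeasurableSet Q := by
    have hm : Measurable fun q : Vec n × (Vec n × Vec d) => (q.1 + q.2.1, q.2.2) := by fun_prop
    exact hm (measurableSet_regularSet hG.measurable)
  have hQx : ∀ v ∈ X, ∀ᵐ q ∂((unifBall n ε).prod ν), (v, q) ∈ Q := by
    intro v hv
    have hQv : MeasurableSet {q : Vec n × Vec d | (v, q) ∈ Q} := measurable_prodMk_left hQ
    -- In the swapped order the parameter is fixed first, as Rademacher's theorem requires.
    have h1 : ∀ᵐ q ∂(ν.prod (unifBall n ε)), (v, q.swap) ∈ Q := by
      rw [Measure.ae_prod_iff_ae_ae (p := fun q : Vec d × Vec n => (v, q.swap) ∈ Q)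
        (measurable_swap hQv)]
      filter_upwards [hG.ae_eq, hG.ae_lipschitz] with ζ h2 h3
      exact ae_mem_regularSet hε h2 h3 hv
    rw [← Measure.prod_swap] at h1
    exact ae_of_ae_map measurable_swap.aemeasurable h1
  have hreg : ∀ᵐ ω ∂P, (y ω, (z k ω, ξ k ω)) ∈ Q := by
    refine ae_comp_of_indep ((historyFiltration hrun.measurable_init hrun.measurable_sample).le k)
      (hrun.measurable_sample k) (indep_historyFiltration hrun.measurable_init
        hrun.measurable_sample hrun.indep_sample hrun.indep_init k) hy hQ ?_
    rw [hrun.law_sample k]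
    filter_upwards [hyX] with ω hω using hQx _ hω
  filter_upwards [hreg, hyX, hxy, hrun.subgradient k,
    hrun.ae_sample (Measure.quasiMeasurePreserving_snd.ae hG.ae_eq) k,
    hrun.ae_sample (IsSurrogate.ae_norm_lt hε) k] with ω h1 h2 h3 h4 h5 h6
  rw [h3] at h4
  exact eq_upperGrad_of_mem_subdiff hXD h5 (enlarge_mem_nhds h2 h6) h1 h4

/-- Agreement at stage `k` forces the subgradient to be the upper gradient, and uniqueness of the
projection carries agreement to stage `k + 1`. -/
theorem IsRun.ae_eq_adaptedRun [IsProbabilityMeasure P]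
    (hrun : IsRun D X F ν ε γ P x z s ξ)
    (hG : IsSurrogate D X F ν ε C G) (hε : 0 < ε) (hXD : enlarge X ε ⊆ D)
    (hXconv : Convex ℝ X) (hprojm : Measurable proj) (hproj : ∀ v, IsProj X v (proj v)) (k : ℕ) :
    ∀ᵐ ω ∂P, x k ω = adaptedRun proj γ G (x 0) (fun k ω => (z k ω, ξ k ω)) k ω ∧
      adaptedRun proj γ G (x 0) (fun k ω => (z k ω, ξ k ω)) k ω ∈ X := by
  induction k with
  | zero =>
    filter_upwards [hrun.init_mem] with ω hω
    exact ⟨rfl, hω⟩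
  | succ k ih =>
    have hs := hrun.ae_eq_upperGrad hG hε hXD k
      (measurable_adaptedRun hprojm γ hG.measurable hrun.measurable_init hrun.measurable_sample k)
      (ih.mono fun _ h => h.2) (ih.mono fun _ h => h.1)
    filter_upwards [ih, hs, hrun.step k] with ω h1 h2 h3
    refine ⟨?_, (hproj _).1⟩
    rw [h2, h1.1] at h3
    exact h3.unique hXconv (hproj _)

/-- The basic inequality of the subgradient method, in terms of the surrogate integrand. -/
theorem IsRun.ae_norm_sq_le (hrun : IsRun D X F ν ε γ P x z s ξ)
    (hG : IsSurrogate D X F ν ε C G) (hε : 0 < ε) (hXD : enlarge X ε ⊆ D)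
    (hXconv : Convex ℝ X) (hγ : ∀ k, 0 < γ k) (k : ℕ) (hx : ∀ᵐ ω ∂P, x k ω ∈ X)
    {y : Vec n} (hy : y ∈ X) :
    ∀ᵐ ω ∂P, ‖x (k + 1) ω - y‖ ^ 2 ≤ ‖x k ω - y‖ ^ 2
      - 2 * γ k * (G (x k ω + z k ω, ξ k ω) - G (y + z k ω, ξ k ω)) + C ^ 2 * γ k ^ 2 := by
  filter_upwards [hx, hrun.subgradient k, hrun.step k,
    hrun.ae_sample (Measure.quasiMeasurePreserving_snd.ae hG.ae_eq) k,
    hrun.ae_sample (Measure.quasiMeasurePreserving_snd.ae hG.ae_subdiff_bound) k,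
    hrun.ae_sample (IsSurrogate.ae_norm_lt hε) k] with ω h1 h2 h3 h4 h5 h6
  have hx' := mem_enlarge h1 h6.le
  have hy' := mem_enlarge hy h6.le
  have h7 := h3.norm_sq_le hXconv (h5 _ hx' _ h2) hy
  have h8 := h2 _ (hXD hy')
  rw [add_sub_add_right_eq_sub] at h8
  rw [h4 _ hx', h4 _ hy']
  have h9 := mul_le_mul_of_nonneg_left h8 (by linarith [hγ k] : (0 : ℝ) ≤ 2 * γ k)
  linarith

theorem IsRun.ae_abs_sub_le (hrun : IsRun D X F ν ε γ P x z s ξ)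
    (hG : IsSurrogate D X F ν ε C G) (hε : 0 < ε) (k : ℕ) {w : W → Vec n}
    (hw : ∀ᵐ ω ∂P, w ω ∈ X) {y : Vec n} (hy : y ∈ X) :
    ∀ᵐ ω ∂P, |G (w ω + z k ω, ξ k ω) - G (y + z k ω, ξ k ω)| ≤ C * ‖w ω - y‖ := by
  filter_upwards [hw, hrun.ae_sample (Measure.quasiMeasurePreserving_snd.ae hG.ae_eq) k,
    hrun.ae_sample (Measure.quasiMeasurePreserving_snd.ae hG.ae_lipschitz) k,
    hrun.ae_sample (IsSurrogate.ae_norm_lt hε) k] with ω h1 h2 h3 h4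
  have hx' := mem_enlarge h1 h4.le
  have hy' := mem_enlarge hy h4.le
  rw [h2 _ hx', h2 _ hy']
  simpa using h3 _ hx' _ hy'

/-- For each minimizer, the distance of the iterates to it converges almost surely, and the
weighted optimality gaps are summable. -/
theorem IsRun.ae_tendsto_norm_sub [IsProbabilityMeasure P]
    (hrun : IsRun D X F ν ε γ P x z s ξ)
    (hG : IsSurrogate D X F ν ε C G) (hε : 0 < ε) (hC : 0 ≤ C) (hXD : enlarge X ε ⊆ D)
    (hXconv : Convex ℝ X) (hFint : ∀ v ∈ X, Integrable (F v) ν) (hγ : ∀ k, 0 < γ k)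
    (hγsq : Summable fun k => γ k ^ 2) {u : ℕ → W → Vec n}
    (hu : ∀ k, Measurable[historyFiltration hrun.measurable_init hrun.measurable_sample k] (u k))
    (hux : ∀ k, ∀ᵐ ω ∂P, x k ω = u k ω ∧ u k ω ∈ X) {y : Vec n}
    (hy : y ∈ optSet X (smoothObjective F ν ε)) :
    ∀ᵐ ω ∂P, (∃ l, Tendsto (fun k => ‖u k ω - y‖) atTop (𝓝 l)) ∧
      Summable fun k => γ k * (smoothObjective F ν ε (u k ω) - smoothObjective F ν ε y) := by
  have := isProbabilityMeasure_unifBall n hε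
  let ℱ := historyFiltration hrun.measurable_init hrun.measurable_sample
  have hu0 : ∀ k, Measurable (u k) := fun k => (hu k).mono (ℱ.le k) le_rfl
  have huX : ∀ k, ∀ᵐ ω ∂P, u k ω ∈ X := fun k => (hux k).mono fun _ h => h.2
  have hsq : Measurable fun v : Vec n => ‖v - y‖ ^ 2 := by fun_prop
  -- Both values use the same perturbation, so the difference is Lipschitz in the iterate and its
  -- mean is the gap of the smoothed objective.
  let Ψ : Vec n × (Vec n × Vec d) → ℝ := fun q =>
    G (q.1 + q.2.1, q.2.2) - G (y + q.2.1, q.2.2)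
  have hΨ : Measurable Ψ :=
    (hG.measurable.comp (by fun_prop)).sub (hG.measurable.comp (by fun_prop))
  let h : Vec n → ℝ := fun v => ∫ q, Ψ (v, q) ∂((unifBall n ε).prod ν)
  have hh : StronglyMeasurable h := hΨ.stronglyMeasurable.integral_prod_right'
  have hheq : ∀ v ∈ X, h v = smoothObjective F ν ε v - smoothObjective F ν ε y := fun v hv =>
    hG.smoothObjective_sub hε hC hv hy.1 (hFint v hv) (hFint y hy.1)
  have hbasic : ∀ k, ∀ᵐ ω ∂P, ‖u (k + 1) ω - y‖ ^ 2 ≤ ‖u k ω - y‖ ^ 2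
      - 2 * γ k * Ψ (u k ω, (z k ω, ξ k ω)) + C ^ 2 * γ k ^ 2 := fun k => by
    have hxX : ∀ᵐ ω ∂P, x k ω ∈ X := by
      filter_upwards [hux k] with ω h1
      rw [h1.1]; exact h1.2
    filter_upwards [hux k, hux (k + 1),
      hrun.ae_norm_sq_le hG hε hXD hXconv hγ k hxX hy.1] with ω h1 h2 h3
    rw [h1.1, h2.1] at h3
    exact h3
  have hΨle : ∀ k, ∀ᵐ ω ∂P, |Ψ (u k ω, (z k ω, ξ k ω))| ≤ C * ‖u k ω - y‖ := fun k =>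
    hrun.ae_abs_sub_le hG hε k (huX k) hy.1
  have hai : ∀ k, Integrable (fun ω => ‖u k ω - y‖ ^ 2) P := fun k => by
    induction k with
    | zero =>
      have h1 : MemLp (fun ω => x 0 ω - y) 2 P := hrun.init_memLp.sub (memLp_const y)
      refine (h1.integrable_norm_pow two_ne_zero).congr ?_
      filter_upwards [hux 0] with ω h2
      rw [h2.1]
    | succ k ih =>
      -- The cross term obeys `2 γ C ‖u - y‖ ≤ ‖u - y‖² + C² γ²`.
      have hdom : Integrable (fun ω => 2 * ‖u k ω - y‖ ^ 2 + 2 * (C ^ 2 * γ k ^ 2)) P :=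
        (ih.const_mul 2).add (integrable_const _)
      refine hdom.mono' (hsq.comp (hu0 (k + 1))).aestronglyMeasurable ?_
      filter_upwards [hbasic k, hΨle k] with ω h1 h2
      rw [Real.norm_eq_abs, abs_of_nonneg (by positivity)]
      have h3 := mul_le_mul_of_nonneg_left (neg_le_of_abs_le h2)
        (by linarith [hγ k] : (0 : ℝ) ≤ 2 * γ k)
      nlinarith [sq_nonneg (‖u k ω - y‖ - C * γ k)]
  have hnormi : ∀ k, Integrable (fun ω => C * (1 + ‖u k ω - y‖ ^ 2)) P := fun k =>
    ((integrable_const 1).add (hai k)).const_mul C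
  have hnormle : ∀ k ω, C * ‖u k ω - y‖ ≤ C * (1 + ‖u k ω - y‖ ^ 2) := fun k ω =>
    mul_le_mul_of_nonneg_left (by nlinarith [sq_nonneg (‖u k ω - y‖ - 1)]) hC
  have hΨi : ∀ k, Integrable (fun ω => Ψ (u k ω, (z k ω, ξ k ω))) P := fun k => by
    refine (hnormi k).mono'
      (hΨ.comp ((hu0 k).prodMk (hrun.measurable_sample k))).aestronglyMeasurable ?_
    filter_upwards [hΨle k] with ω h1
    exact h1.trans (hnormle k ω)
  have hhi : ∀ k, Integrable (fun ω => h (u k ω)) P := fun k => by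
    refine (hnormi k).mono' (hh.measurable.comp (hu0 k)).aestronglyMeasurable ?_
    filter_upwards [huX k] with ω h1
    rw [hheq _ h1]
    exact (hG.abs_smoothObjective_sub_le hε hC h1 hy.1 (hFint _ h1) (hFint y hy.1)).trans
      (hnormle k ω)
  have hstep : ∀ k (A : Set W), MeasurableSet[ℱ k] A →
      ∫ ω in A, ‖u (k + 1) ω - y‖ ^ 2 ∂P + ∫ ω in A, 2 * γ k * h (u k ω) ∂P ≤
        ∫ ω in A, ‖u k ω - y‖ ^ 2 ∂P + ∫ _ in A, C ^ 2 * γ k ^ 2 ∂P := fun k A hA => by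
    have h1 : ∫ ω in A, Ψ (u k ω, (z k ω, ξ k ω)) ∂P = ∫ ω in A, h (u k ω) ∂P := by
      rw [setIntegral_comp_eq_of_indep (ℱ.le k) (hrun.measurable_sample k)
        (indep_historyFiltration hrun.measurable_init hrun.measurable_sample hrun.indep_sample
          hrun.indep_init k) (hu k) hA hΨ (hΨi k), hrun.law_sample k]
    have i1 := (hai k).restrict (s := A)
    have i2 : Integrable (fun ω => 2 * γ k * Ψ (u k ω, (z k ω, ξ k ω))) (P.restrict A) :=
      ((hΨi k).const_mul (2 * γ k)).restrict
    have i3 : Integrable (fun _ => C ^ 2 * γ k ^ 2) (P.restrict A) := integrable_const _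
    have i12 : Integrable (fun ω => ‖u k ω - y‖ ^ 2 - 2 * γ k * Ψ (u k ω, (z k ω, ξ k ω)))
        (P.restrict A) := i1.sub i2
    have h2 := integral_mono_ae (hai (k + 1)).restrict (i12.add i3)
      (ae_restrict_of_ae (s := A) (hbasic k))
    rw [integral_add' i12 i3, integral_sub i1 i2, integral_const_mul, h1] at h2
    rw [integral_const_mul]
    linarith
  have hconv := ae_tendsto_and_summable_of_almost_supermartingale (ℱ := ℱ)
    (a := fun k ω => ‖u k ω - y‖ ^ 2) (b := fun k ω => 2 * γ k * h (u k ω))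
    (c := fun k => C ^ 2 * γ k ^ 2)
    (fun k => (hsq.comp (hu k)).stronglyMeasurable)
    (fun k => ((hh.measurable.comp (hu k)).const_mul _).stronglyMeasurable)
    hai (fun k => (hhi k).const_mul _) (fun k => Eventually.of_forall fun ω => by positivity)
    (fun k => by
      filter_upwards [huX k] with ω h1
      have h2 : 0 ≤ h (u k ω) := by rw [hheq _ h1]; exact sub_nonneg.2 (hy.2 _ h1)
      exact mul_nonneg (by linarith [hγ k]) h2)
    (fun k => by positivity) (hγsq.mul_left _) hstep
  filter_upwards [hconv, ae_all_iff.2 huX] with ω h1 h2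
  obtain ⟨⟨l, hl⟩, hsum⟩ := h1
  refine ⟨⟨√l, ?_⟩, ?_⟩
  · simpa [Real.sqrt_sq] using hl.sqrt
  · refine (hsum.mul_left 2⁻¹).congr fun k => ?_
    rw [hheq _ (h2 k)]
    ring

/-- The iterates converge almost surely to a minimizer of the smoothed objective. -/
theorem IsRun.exists_measurable_limit [IsProbabilityMeasure P]
    (hrun : IsRun D X F ν ε γ P x z s ξ)
    (hG : IsSurrogate D X F ν ε C G) (hε : 0 < ε) (hXD : enlarge X ε ⊆ D)
    (hXne : X.Nonempty) (hXc : IsClosed X)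
    (hXconv : Convex ℝ X) (hFint : ∀ v ∈ X, Integrable (F v) ν) (hγ : ∀ k, 0 < γ k)
    (hγsum : ¬ Summable γ) (hγsq : Summable fun k => γ k ^ 2)
    (hopt : (optSet X (smoothObjective F ν ε)).Nonempty) :
    ∃ xstar : W → Vec n, Measurable xstar ∧
      ∀ᵐ ω ∂P, xstar ω ∈ optSet X (smoothObjective F ν ε) ∧
        Tendsto (fun k => x k ω) atTop (𝓝 (xstar ω)) := by
  have hC := hG.const_nonneg hε hXne
  obtain ⟨proj, hprojm, hproj⟩ := exists_measurable_proj hXne hXc hXconv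
  let u := adaptedRun proj γ G (x 0) (fun k ω => (z k ω, ξ k ω))
  have hu : ∀ k, Measurable[historyFiltration hrun.measurable_init hrun.measurable_sample k]
      (u k) :=
    measurable_adaptedRun hprojm γ hG.measurable hrun.measurable_init hrun.measurable_sample
  have hux : ∀ k, ∀ᵐ ω ∂P, x k ω = u k ω ∧ u k ω ∈ X :=
    hrun.ae_eq_adaptedRun hG hε hXD hXconv hprojm hproj
  -- The exceptional null set depends on the minimizer, so only countably many may be used at once.
  obtain ⟨S, hSsub, hScount, hSdense⟩ := (TopologicalSpace.IsSeparable.of_separableSpace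
    (optSet X (smoothObjective F ν ε))).exists_countable_dense_subset
  have hSne : S.Nonempty := closure_nonempty_iff.1 (hopt.mono hSdense)
  have hall := (ae_ball_iff hScount).2 fun y hy =>
    hrun.ae_tendsto_norm_sub hG hε hC hXD hXconv hFint hγ hγsq hu hux (hSsub hy)
  have hlim : ∀ᵐ ω ∂P, ∃ l ∈ optSet X (smoothObjective F ν ε),
      Tendsto (fun k => u k ω) atTop (𝓝 l) := by
    filter_upwards [hall, ae_all_iff.2 hux] with ω h1 h2
    exact exists_tendsto_of_tendsto_dist hXc (hG.continuousOn_smoothObjective hε hC hFint) hSne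
      hSsub hSdense (fun k => (h2 k).2) (fun y hy => (h1 y hy).1) hγ hγsum
      (fun y hy => (h1 y hy).2)
  -- The limit is taken along `u`, whose terms are known to be measurable, and then transferred to
  -- `x`.
  obtain ⟨xstar, hmeas, hxstar⟩ := measurable_limit_of_tendsto_metrizable_ae (L := atTop)
    (f := u) (fun k => ((hu k).mono (Filtration.le _ k) le_rfl).aemeasurable)
    (hlim.mono fun ω ⟨l, _, hl⟩ => ⟨l, hl⟩)
  refine ⟨xstar, hmeas, ?_⟩
  filter_upwards [hlim, hxstar, ae_all_iff.2 hux] with ω ⟨l, hl, hlt⟩ h2 h3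
  have he : xstar ω = l := tendsto_nhds_unique h2 hlt
  exact ⟨he ▸ hl, h2.congr fun k => (h3 k).1.symm⟩

end Run

end LocalSmoothing

/-! ### The main theorem -/

theorem mainTheorem9 {n d : ℕ}
    -- the domain, the feasible set, and the smoothing radius
    (D X : Set (LocalSmoothing.Vec n)) (ε : ℝ) (hε : 0 < ε)
    (hD : IsOpen D) (hXne : X.Nonempty) (hXc : IsClosed X) (hXconv : Convex ℝ X)
    (hXD : LocalSmoothing.enlarge X ε ⊆ D)
    -- the law `ν` of the random vector, carried by the set `Ω`
    (Ω : Set (LocalSmoothing.Vec d)) (ν : Measure (LocalSmoothing.Vec d))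
    [IsProbabilityMeasure ν] (hΩ : ∀ᵐ ξ ∂ν, ξ ∈ Ω)
    -- the integrand
    (F : LocalSmoothing.Vec n → LocalSmoothing.Vec d → ℝ)
    (hFconv : ∀ ξ ∈ Ω, ConvexOn ℝ D (fun x => F x ξ))
    (hFint : ∀ x ∈ D, Integrable (F x) ν)
    (C : ℝ)
    (hC : ∀ x ∈ LocalSmoothing.enlarge X ε, ∀ ξ ∈ Ω,
      ∀ s ∈ LocalSmoothing.subdiff D (fun y => F y ξ) x, ‖s‖ ≤ C)
    -- the stepsizes
    (γ : ℕ → ℝ) (hγpos : ∀ k, 0 < γ k) (hγsum : ¬ Summable γ)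
    (hγsq : Summable (fun k => γ k ^ 2)) :
    -- the smoothed objective is well defined on `X`
    (∀ x ∈ X, Integrable
      (fun p : LocalSmoothing.Vec n × LocalSmoothing.Vec d => F (x + p.1) p.2)
      ((LocalSmoothing.unifBall n ε).prod ν)) ∧
    -- the optimal values satisfy `f* ≤ f̂* ≤ f* + ε C`
    LocalSmoothing.optValue X (LocalSmoothing.objective F ν) ≤
      LocalSmoothing.optValue X (LocalSmoothing.smoothObjective F ν ε) ∧
    LocalSmoothing.optValue X (LocalSmoothing.smoothObjective F ν ε) ≤
      LocalSmoothing.optValue X (LocalSmoothing.objective F ν) + ((ε * C : ℝ) : EReal) ∧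
    -- almost sure convergence to a random optimal solution of the smoothed problem
    ((LocalSmoothing.optSet X (LocalSmoothing.smoothObjective F ν ε)).Nonempty →
      ∀ {W : Type*} [MeasurableSpace W] (P : Measure W) [IsProbabilityMeasure P]
        (x z s : ℕ → W → LocalSmoothing.Vec n) (ξ : ℕ → W → LocalSmoothing.Vec d),
        LocalSmoothing.IsRun D X F ν ε γ P x z s ξ →
        ∃ xstar : W → LocalSmoothing.Vec n, Measurable xstar ∧
          ∀ᵐ ω ∂P, xstar ω ∈
              LocalSmoothing.optSet X (LocalSmoothing.smoothObjective F ν ε) ∧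
            Tendsto (fun k => x k ω) atTop (𝓝 (xstar ω))) := by
  have hself : ∀ x ∈ X, x ∈ D := fun x hx => hXD (LocalSmoothing.mem_enlarge_self hε hx)
  have hFX : ∀ x ∈ X, Integrable (F x) ν := fun x hx => hFint x (hself x hx)
  obtain ⟨G, hG⟩ := LocalSmoothing.exists_isSurrogate hε hD hXne hXD hΩ hFconv hFint hC
  have hC0 : 0 ≤ C := hG.const_nonneg hε hXne
  refine ⟨fun x hx => hG.integrable_prod hε hC0 hx (hFX x hx), ?_, ?_, ?_⟩
  · exact LocalSmoothing.optValue_mono fun x hx => hG.objective_le hε hC0 hXD hx (hFX x hx)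
  · exact LocalSmoothing.optValue_le_add fun x hx => hG.smoothObjective_le hε hC0 hx (hFX x hx)
  · intro hopt W _ P _ x z s ξ hrun
    exact hrun.exists_measurable_limit hG hε hXD hXne hXc hXconv hFX hγpos hγsum hγsq hopt
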